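/- Let $k$ be a field of characteristic $p>0$ with $[k:k^p]<\infty$, and let $f\colon R\to S$ be a homomorphism of $k$-algebras of finite type. Assume that for every ${\mathfrak q}\in\operatorname{Spec}(R)$ the fiber ring $S\otimes_R k({\mathfrak q})$ is regular and of pure dimension $d$ (every irreducible component of its spectrum has dimension $d$). Let $\phi\colon S\to R$ be a ring homomorphism with $\phi\circ f=\mathrm{id}_R$, and for ${\mathfrak q}\in\operatorname{Spec}(R)$ put ${\mathfrak q}'=\phi^{-1}({\mathfrak q})$. Let ${\mathfrak a}$ be an ideal of $S$ such that ${\mathfrak a}\subseteq{\mathfrak q}'$ for all ${\mathfrak q}\in\operatorname{Spec}(R)$. Then for every real number $c\geq 0$, the set $$\{{\mathfrak q}\in\operatorname{Spec}(R)\mid \operatorname{fpt}({\mathfrak a}\cdot S_{{\mathfrak q}'}/{\mathfrak q}S_{{\mathfrak q}'})\geq c\}$$ is open in $\operatorname{Spec}(R)$. Here, for an ideal ${\mathfrak b}$ of an $F$-finite regular local ring $A$ of characteristic $p$ (a domain), $\operatorname{fpt}({\mathfrak b})$ is defined as follows. For an ideal $J$ of $A$ and $q=p^e$ let $J^{[q]}=(u^q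 : u\in J)$. For real $t\geq 0$, let $I^{*{\mathfrak b}^t}$ be the set of all $z\in A$ for which there is a nonzero $c\in A$ with $c\,z^q\,{\mathfrak b}^{\lceil tq\rceil}\subseteq I^{[q]}$ for all large $q=p^e$, and let $\tau({\mathfrak b}^t)=\bigcap_{I}(I: I^{*{\mathfrak b}^t})$, where $I$ runs through all ideals of $A$. If ${\mathfrak b}\neq 0$ is a proper ideal, $\operatorname{fpt}({\mathfrak b})$ is the smallest real number $\lambda>0$ such that $\tau({\mathfrak b}^\lambda)\neq\tau({\mathfrak b}^t)$ for every $0\leq t<\lambda$; moreover $\operatorname{fpt}(0)=0$. -/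

import Mathlib

open scoped ENNReal

namespace FThreshold

noncomputable section

variable {A : Type*} [CommRing A]

/-- The ideal `J^{[n]} = (u ^ n : u ∈ J)`; it is used for `n = p ^ e`, where `p` is the
characteristic of `A`. -/
def frobeniusPower (J : Ideal A) (n : ℕ) : Ideal A :=
  Ideal.span ((fun u : A => u ^ n) '' (J : Set A))

/-- `A°`, the complement of the union of the minimal primes of `A`. -/
def circ (A : Type*) [CommRing A] : Set A :=
  {c | ∀ P ∈ minimalPrimes A, c ∉ P}

/-- The `𝔞^t`-tight closure of `I`: the elements `z` for which there is `c ∈ A°` such that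
`c z^q 𝔞^⌈t q⌉ ⊆ I^{[q]}` for all large `q = p ^ e`. -/
def tightClosure (p : ℕ) (𝔞 : Ideal A) (t : ℝ) (I : Ideal A) : Set A :=
  {z | ∃ c ∈ circ A, ∃ e₀ : ℕ, ∀ e ≥ e₀, ∀ y ∈ 𝔞 ^ ⌈t * (p : ℝ) ^ e⌉₊,
    c * z ^ p ^ e * y ∈ frobeniusPower I (p ^ e)}

/-- The generalized test ideal `τ(𝔞^t) = ⋂_I (I : I^{*𝔞^t})`, where `I` runs through all ideals
of `A`. -/
def testIdeal (p : ℕ) (𝔞 : Ideal A) (t : ℝ) : Ideal A where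
  carrier := {x | ∀ I : Ideal A, ∀ z ∈ tightClosure p 𝔞 t I, x * z ∈ I}
  add_mem' := fun {x y} hx hy I z hz => by
    rw [add_mul]
    exact I.add_mem (hx I z hz) (hy I z hz)
  zero_mem' := fun I z _ => by
    rw [zero_mul]
    exact I.zero_mem
  smul_mem' := fun b x hx I z hz => by
    rw [smul_eq_mul, mul_assoc]
    exact I.mul_mem_left b (hx I z hz)

/-- The positive `F`-jumping exponents of `𝔞`: the real numbers `s > 0` such that
`τ(𝔞^s) ≠ τ(𝔞^t)` for every `0 ≤ t < s`. -/
def IsPosJumpingExponent (p : ℕ) (𝔞 : Ideal A) (s : ℝ) : Prop :=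
  0 < s ∧ ∀ t : ℝ, 0 ≤ t → t < s → testIdeal p 𝔞 s ≠ testIdeal p 𝔞 t

/-- The `F`-pure threshold of an ideal (of a regular local `F`-finite ring of characteristic `p`):
the smallest positive `F`-jumping exponent, with the usual convention `fpt(0) = 0`. If `𝔞` is the
unit ideal there is no positive jumping exponent, and the value is `∞`. -/
def fpt (p : ℕ) (𝔞 : Ideal A) : ℝ≥0∞ :=
  open scoped Classical in
  if 𝔞 = ⊥ then 0 else sInf (ENNReal.ofReal '' {s : ℝ | IsPosJumpingExponent p 𝔞 s})

/-- A ring has pure dimension `d` if all the irreducible components of its spectrum have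
dimension `d`. -/
def HasPureDimension (A : Type*) [CommRing A] (d : ℕ) : Prop :=
  ∀ P ∈ minimalPrimes A, ringKrullDim (A ⧸ P) = d

variable {R S : Type*} [CommRing R] [CommRing S] [Algebra R S]

/-- The ideal `𝔮 S_{𝔮'}` of `S_{𝔮'}`, for primes `𝔮` of `R` and `𝔮'` of `S`. -/
def extendedPrime (q : Ideal R) (q' : Ideal S) [q'.IsPrime] : Ideal (Localization.AtPrime q') :=
  (q.map (algebraMap R S)).map (algebraMap S (Localization.AtPrime q'))

/-- The ring `S_{𝔮'} / 𝔮 S_{𝔮'}`. -/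
abbrev LocalFiber (q : Ideal R) (q' : Ideal S) [q'.IsPrime] : Type _ :=
  Localization.AtPrime q' ⧸ extendedPrime q q'

/-- The ideal `𝔞 · S_{𝔮'} / 𝔮 S_{𝔮'}` of `S_{𝔮'} / 𝔮 S_{𝔮'}`. -/
def localFiberIdeal (𝔞 : Ideal S) (q : Ideal R) (q' : Ideal S) [q'.IsPrime] :
    Ideal (LocalFiber q q') :=
  (𝔞.map (algebraMap S (Localization.AtPrime q'))).map (Ideal.Quotient.mk (extendedPrime q q'))

end

end FThreshold

/-! Write `S` as `R[x]/(G)` with variables killed by `φ`. Over a prime `𝔮` with residue field `K`,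
the ring `A = S_{𝔮'}/𝔮S_{𝔮'}` is then the localization of `K[x]/(G)` at the origin. Since `A` is
regular, equations from `G` and variables can be combined into a coordinate system `Y` at the
origin, that is, one with nonzero Jacobian determinant, such that the chosen equations `Y_v`, `v ∈
s`, cut out `A`.

Powers of Frobenius behave flatly on `A` (`HasFrobeniusColon`), so `fpt 𝔟` is the supremum of the `r
/ p^e` with `𝔟^r ⊄ 𝔪^{[p^e]}` (`HasFrobeniusColon.fpt_eq`). Put `y = ∏_{v ∈ s} Y_v` and `q = p^e`.
As in Fedder's criterion, `(x_v^q) : y^(q-1) = (x_v^q) + (Y_v : v ∈ s)`, so noncontainment means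
that some `y^(q-1) ∏ f_j^(i_j)` has a nonzero coefficient at an exponent with all entries below `q`
(`noncontainmentValues_eq_mixedValues`). These coefficients come from `R`, so a witness at one prime
persists on a neighbourhood: the threshold is lower semicontinuous.

To replace `> c'` by `≥ c`, all thresholds are confined to one finite set that depends only on `p`,
the numbers of generators and variables, and degree bounds (`mem_possibleThresholds`). If `v ≠ 0` is
a threshold, then so is `p v - d` for some natural number `d`, and a strictly decreasing family of
spaces of polynomials of bounded degree bounds the number of thresholds. By pigeonhole `(p^i' - p^i)
v` is an integer with `i'` bounded. The pure dimension `d` makes the coordinates chosen at one prime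
valid at nearby primes (`IsLocalPresentation.le_ringKrullDim`). -/

namespace FThreshold

/-! ### Frobenius powers of ideals -/

section FrobeniusPower

variable {A : Type*} [CommRing A] (p : ℕ) [Fact p.Prime] [CharP A p]

/-- `Ideal.map` is by definition the span of the image, so the general facts on extended ideals
become available. -/
theorem frobeniusPower_eq_map (J : Ideal A) (e : ℕ) :
    frobeniusPower J (p ^ e) = J.map (iterateFrobenius A p e) := rfl

theorem frobeniusPower_span (s : Set A) (e : ℕ) :
    frobeniusPower (Ideal.span s) (p ^ e) = Ideal.span ((fun u : A => u ^ p ^ e) '' s) := by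
  rw [frobeniusPower_eq_map, Ideal.map_span]
  rfl

theorem frobeniusPower_frobeniusPower (J : Ideal A) (e e' : ℕ) :
    frobeniusPower (frobeniusPower J (p ^ e)) (p ^ e') = frobeniusPower J (p ^ (e + e')) := by
  simp only [frobeniusPower_eq_map, Ideal.map_map]
  congr 1
  ext x
  simp [iterateFrobenius_def, pow_add, pow_mul]

theorem pow_mem_frobeniusPower {J : Ideal A} {x : A} (hx : x ∈ J) (n : ℕ) :
    x ^ n ∈ frobeniusPower J n :=
  Ideal.subset_span ⟨x, hx, rfl⟩

theorem frobeniusPower_le_pow (J : Ideal A) (n : ℕ) : frobeniusPower J n ≤ J ^ n := by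
  rw [frobeniusPower, Ideal.span_le]
  rintro _ ⟨x, hx, rfl⟩
  exact Ideal.pow_mem_pow hx n

theorem frobeniusPower_le (J : Ideal A) {n : ℕ} (hn : n ≠ 0) : frobeniusPower J n ≤ J :=
  (frobeniusPower_le_pow J n).trans (Ideal.pow_le_self hn)

theorem frobeniusPower_mono {I J : Ideal A} (h : I ≤ J) (n : ℕ) :
    frobeniusPower I n ≤ frobeniusPower J n :=
  Ideal.span_mono (Set.image_mono h)

end FrobeniusPower

/-! ### The threshold as a supremum of noncontainment values -/

section FrobeniusColon

variable {A : Type*} [CommRing A] [IsLocalRing A]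

open IsLocalRing

/-- The colon property of Frobenius powers which holds in local rings with flat Frobenius. -/
def HasFrobeniusColon (A : Type*) [CommRing A] [IsLocalRing A] (p : ℕ) : Prop :=
  ∀ (I : Ideal A) (z : A), z ∉ I → ∀ (e : ℕ) (c : A),
    c * z ^ p ^ e ∈ frobeniusPower I (p ^ e) → c ∈ frobeniusPower (maximalIdeal A) (p ^ e)

/-- The values `r / p ^ e` with `𝔟 ^ r` not contained in `𝔪^{[p ^ e]}`. -/
def noncontainmentValues (p : ℕ) (𝔟 : Ideal A) : Set ℝ :=
  {x | ∃ e r : ℕ, ¬ 𝔟 ^ r ≤ frobeniusPower (maximalIdeal A) (p ^ e) ∧ x = (r : ℝ) / (p : ℝ) ^ e}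

variable {p : ℕ} [Fact p.Prime] [CharP A p]

omit [Fact p.Prime] [CharP A p] in
theorem zero_mem_noncontainmentValues (𝔟 : Ideal A) : (0 : ℝ) ∈ noncontainmentValues p 𝔟 := by
  refine ⟨0, 0, fun h => ?_, by simp⟩
  have h1 : (1 : A) ∈ frobeniusPower (maximalIdeal A) (p ^ 0) := h (by simp)
  exact (maximalIdeal.isMaximal A).ne_top
    ((Ideal.eq_top_iff_one _).2 (frobeniusPower_le _ (by simp) h1))

omit [CharP A p] in
theorem not_pow_le_frobeniusPower_of_ceil {𝔟 : Ideal A} {t : ℝ} {x : ℝ}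
    (hx : x ∈ noncontainmentValues p 𝔟) (htx : t ≤ x) :
    ∃ e : ℕ, ¬ 𝔟 ^ ⌈t * (p : ℝ) ^ e⌉₊ ≤ frobeniusPower (maximalIdeal A) (p ^ e) := by
  obtain ⟨e, r, h, rfl⟩ := hx
  refine ⟨e, fun h' => h (le_trans (Ideal.pow_le_pow_right ?_) h')⟩
  have hp : (0 : ℝ) < (p : ℝ) ^ e := pow_pos (by exact_mod_cast (Fact.out : p.Prime).pos) e
  exact Nat.ceil_le.2 ((le_div_iff₀ hp).1 htx)

variable [IsNoetherianRing A]

omit [CharP A p] in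
theorem eq_zero_of_mem_frobeniusPower {x : A} {e₀ : ℕ}
    (hx : ∀ e ≥ e₀, x ∈ frobeniusPower (maximalIdeal A) (p ^ e)) : x = 0 := by
  have h : x ∈ ⨅ i : ℕ, maximalIdeal A ^ i := by
    rw [Ideal.mem_iInf]
    intro i
    have hi : i ≤ p ^ (e₀ + i) :=
      ((Nat.le_add_left i e₀).trans (Nat.lt_pow_self (Fact.out : p.Prime).one_lt).le)
    exact Ideal.pow_le_pow_right hi (frobeniusPower_le_pow _ _ (hx _ (Nat.le_add_right _ _)))
  rwa [Ideal.iInf_pow_eq_bot_of_isLocalRing _ (maximalIdeal.isMaximal A).ne_top] at h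

omit [IsNoetherianRing A] in
theorem HasFrobeniusColon.mem_of_mul_pow_mem (H : HasFrobeniusColon A p) {u c : A} {e₁ e : ℕ}
    (hu : u ∉ frobeniusPower (maximalIdeal A) (p ^ e₁))
    (h : c * u ^ p ^ e ∈ frobeniusPower (maximalIdeal A) (p ^ (e₁ + e))) :
    c ∈ frobeniusPower (maximalIdeal A) (p ^ e) := by
  refine H _ u hu e c ?_
  rwa [frobeniusPower_frobeniusPower]

/-- The supremum is never attained, so the test ideal is already proper at the supremum itself. If
`u` is a witness and `b ∈ 𝔟` lies outside `𝔪^{[p^e']}`, then `u^(p^e') b` is a witness with a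
slightly larger value. -/
theorem HasFrobeniusColon.exists_gt (H : HasFrobeniusColon A p) {𝔟 : Ideal A} (h𝔟 : 𝔟 ≠ ⊥) {x : ℝ}
    (hx : x ∈ noncontainmentValues p 𝔟) : ∃ y ∈ noncontainmentValues p 𝔟, x < y := by
  obtain ⟨e, r, h, rfl⟩ := hx
  obtain ⟨u, hu, hum⟩ := SetLike.not_le_iff_exists.1 h
  obtain ⟨b, hb, hb0⟩ := Submodule.exists_mem_ne_zero_of_ne_bot h𝔟
  have hex : ∃ e', b ∉ frobeniusPower (maximalIdeal A) (p ^ e') := by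
    by_contra! hcon
    exact hb0 (eq_zero_of_mem_frobeniusPower (e₀ := 0) fun e' _ => hcon e')
  obtain ⟨e', he'⟩ := hex
  refine ⟨_, ⟨e + e', r * p ^ e' + 1, fun hle => he' ?_, rfl⟩, ?_⟩
  · refine H.mem_of_mul_pow_mem hum (hle ?_)
    rw [pow_succ, mul_comm b]
    refine Ideal.mul_mem_mul ?_ hb
    rw [pow_mul]
    exact Ideal.pow_mem_pow hu _
  · have hp : (0 : ℝ) < (p : ℝ) := by exact_mod_cast (Fact.out : p.Prime).pos
    rw [div_lt_div_iff₀ (by positivity) (by positivity)]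
    push_cast
    rw [pow_add]
    have : (0 : ℝ) < (p : ℝ) ^ e := by positivity
    nlinarith

/-- If all the containments hold, then `1` is in the tight closure of `𝔪`, with multiplier `1`.
Conversely, given a witness `u` and `z ∉ I`, the colon property strips first the power of `z` and
then that of `u`, so the multiplier lies in every `𝔪^{[p^e]}` with `e` large and vanishes by Krull's
intersection theorem. -/
theorem HasFrobeniusColon.testIdeal_eq_top_iff (H : HasFrobeniusColon A p) (𝔟 : Ideal A) (t : ℝ) :
    testIdeal p 𝔟 t = ⊤ ↔
      ∃ e : ℕ, ¬ 𝔟 ^ ⌈t * (p : ℝ) ^ e⌉₊ ≤ frobeniusPower (maximalIdeal A) (p ^ e) := by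
  constructor
  · intro htop
    by_contra! hcon
    have h1 : (1 : A) ∈ testIdeal p 𝔟 t := htop ▸ Submodule.mem_top
    have h2 : (1 : A) ∈ tightClosure p 𝔟 t (maximalIdeal A) := by
      refine ⟨1, fun P hP h => ?_, 0, fun e _ y hy => ?_⟩
      · exact (Ideal.IsMinimalPrime.isPrime hP).ne_top ((Ideal.eq_top_iff_one _).2 h)
      · simpa using hcon e hy
    have h3 := h1 (maximalIdeal A) 1 h2
    rw [mul_one] at h3
    exact (maximalIdeal.isMaximal A).ne_top ((Ideal.eq_top_iff_one _).2 h3)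
  · rintro ⟨e₁, h⟩
    obtain ⟨u, hu, hum⟩ := SetLike.not_le_iff_exists.1 h
    rw [Ideal.eq_top_iff_one]
    rintro I z ⟨c, hc, e₀, hz⟩
    rw [one_mul]
    by_contra hzI
    have hc0 : c = 0 := by
      refine eq_zero_of_mem_frobeniusPower (p := p) (e₀ := e₀) fun e he => ?_
      refine H.mem_of_mul_pow_mem hum ?_
      refine H I z hzI _ _ ?_
      have := hz (e₁ + e) (by omega) (u ^ p ^ e) ?_
      · convert this using 1; ring
      · have h1 : u ^ p ^ e ∈ 𝔟 ^ (⌈t * (p : ℝ) ^ e₁⌉₊ * p ^ e) := by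
          rw [pow_mul]
          exact Ideal.pow_mem_pow hu _
        refine Ideal.pow_le_pow_right (Nat.ceil_le.2 ?_) h1
        push_cast
        rw [pow_add, ← mul_assoc]
        exact mul_le_mul_of_nonneg_right (Nat.le_ceil _) (by positivity)
    obtain ⟨P, hP⟩ := Ideal.nonempty_minimalPrimes (bot_ne_top (α := Ideal A))
    exact hc P hP (hc0 ▸ P.zero_mem)

theorem HasFrobeniusColon.fpt_eq (H : HasFrobeniusColon A p) {𝔟 : Ideal A} {v : ℝ}
    (hv : IsLUB (noncontainmentValues p 𝔟) v) : fpt p 𝔟 = ENNReal.ofReal v := by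
  classical
  by_cases h𝔟 : 𝔟 = ⊥
  -- For the zero ideal only `r = 0` gives a noncontainment, in agreement with the convention
  -- `fpt(0) = 0`.
  · have hle : v ≤ 0 := by
      refine hv.2 ?_
      rintro _ ⟨e, r, h, rfl⟩
      rcases r with _ | r
      · simp
      · exact absurd (by rw [h𝔟, Ideal.bot_pow (Nat.succ_ne_zero r)]; exact bot_le) h
    rw [fpt, if_pos h𝔟, ENNReal.ofReal_of_nonpos hle]
  rw [fpt, if_neg h𝔟]
  have hlt : ∀ x ∈ noncontainmentValues p 𝔟, x < v := fun x hx => by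
    obtain ⟨y, hy, hxy⟩ := H.exists_gt h𝔟 hx
    exact hxy.trans_le (hv.1 hy)
  have hv0 : 0 < v := hlt 0 (zero_mem_noncontainmentValues 𝔟)
  have htop : ∀ t : ℝ, t < v → testIdeal p 𝔟 t = ⊤ := fun t ht => by
    obtain ⟨x, hx, htx, -⟩ := hv.exists_between ht
    exact (H.testIdeal_eq_top_iff 𝔟 t).2 (not_pow_le_frobeniusPower_of_ceil hx htx.le)
  have hntop : testIdeal p 𝔟 v ≠ ⊤ := fun h => by
    obtain ⟨e, he⟩ := (H.testIdeal_eq_top_iff 𝔟 v).1 h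
    have h1 := hlt _ ⟨e, _, he, rfl⟩
    have hp : (0 : ℝ) < (p : ℝ) ^ e := pow_pos (by exact_mod_cast (Fact.out : p.Prime).pos) e
    rw [div_lt_iff₀ hp] at h1
    exact (Nat.le_ceil _).not_gt h1
  -- The test ideal is the unit ideal below `v` and proper at `v`, so `v` is the first jump.
  refine IsLeast.csInf_eq ⟨⟨v, ⟨hv0, fun t _ ht => by rwa [htop t ht]⟩, rfl⟩, ?_⟩
  rintro _ ⟨s, ⟨hs0, hs⟩, rfl⟩
  refine ENNReal.ofReal_le_ofReal (not_lt.1 fun hsv => ?_)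
  exact hs 0 le_rfl hs0 (by rw [htop s hsv, htop 0 hv0])

end FrobeniusColon

end FThreshold

namespace FThreshold

/-! ### Root components of polynomials under Frobenius -/

open MvPolynomial

section FrobeniusRoot

variable {σ K : Type*} [Field K] (p : ℕ) [Fact p.Prime] [CharP K p]

/-- `h` is the `p ^ e`-th root of the component of `F` in the residue class of exponents
`γ` modulo `p ^ e`. -/
def IsFrobeniusRoot (e : ℕ) (γ : σ →₀ ℕ) (F h : MvPolynomial σ K) : Prop :=
  ∀ δ : σ →₀ ℕ, coeff δ h ^ p ^ e = coeff (p ^ e • δ + γ) F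

theorem smul_add_right_injective {q : ℕ} (hq : q ≠ 0) (γ : σ →₀ ℕ) :
    Function.Injective fun δ : σ →₀ ℕ => q • δ + γ := fun a b h => by
  ext v
  have h1 : q • a = q • b := add_right_cancel h
  have h2 := DFunLike.congr_fun h1 v
  simpa [hq] using h2

variable {p}

theorem pow_char_pow_injective (K : Type*) [Field K] [CharP K p] (e : ℕ) :
    Function.Injective fun x : K => x ^ p ^ e := by
  have : ExpChar K p := ExpChar.prime Fact.out
  exact iterateFrobenius_inj K p e

theorem exists_isFrobeniusRoot [PerfectRing K p] (e : ℕ) (γ : σ →₀ ℕ) (F : MvPolynomial σ K) :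
    ∃ h, IsFrobeniusRoot p e γ F h := by
  classical
  have hq : p ^ e ≠ 0 := pow_ne_zero _ (Fact.out : p.Prime).ne_zero
  set D := (F.support.preimage (fun δ : σ →₀ ℕ => p ^ e • δ + γ)
    (smul_add_right_injective hq γ).injOn) with hD
  refine ⟨∑ δ ∈ D, monomial δ ((iterateFrobeniusEquiv K p e).symm (coeff (p ^ e • δ + γ) F)),
    fun δ => ?_⟩
  rw [coeff_sum]
  simp only [coeff_monomial]
  rw [Finset.sum_ite_eq' D δ]
  have hroot : ∀ x : K, ((iterateFrobeniusEquiv K p e).symm x) ^ p ^ e = x := fun x => by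
    rw [← iterateFrobenius_def, ← iterateFrobeniusEquiv_apply, RingEquiv.apply_symm_apply]
  split_ifs with h
  · exact hroot _
  · rw [zero_pow hq]
    have : p ^ e • δ + γ ∉ F.support := by simpa [hD] using h
    exact (notMem_support_iff.1 this).symm

theorem IsFrobeniusRoot.unique {e : ℕ} {γ : σ →₀ ℕ} {F h h' : MvPolynomial σ K}
    (H : IsFrobeniusRoot p e γ F h) (H' : IsFrobeniusRoot p e γ F h') : h = h' := by
  ext δ
  exact pow_char_pow_injective K e ((H δ).trans (H' δ).symm)

theorem IsFrobeniusRoot.add {e : ℕ} {γ : σ →₀ ℕ} {F F' h h' : MvPolynomial σ K}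
    (H : IsFrobeniusRoot p e γ F h) (H' : IsFrobeniusRoot p e γ F' h') :
    IsFrobeniusRoot p e γ (F + F') (h + h') := fun δ => by
  rw [coeff_add, coeff_add, add_pow_char_pow, H δ, H' δ]

omit [Fact p.Prime] [CharP K p] in
theorem IsFrobeniusRoot.C_mul {e : ℕ} {γ : σ →₀ ℕ} {F h : MvPolynomial σ K}
    (H : IsFrobeniusRoot p e γ F h) (a : K) :
    IsFrobeniusRoot p e γ (C (a ^ p ^ e) * F) (C a * h) := fun δ => by
  rw [coeff_C_mul, coeff_C_mul, mul_pow, H δ]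

/-- Taking root components is linear over `p^e`-th powers: `g^(p^e)` only involves exponents
divisible by `p^e`, so it preserves residue classes. The bound on `γ` ensures that `p^e a ≤ p^e δ +
γ` forces `a ≤ δ`. -/
theorem coeff_pow_mul_of_isFrobeniusRoot {e : ℕ} {γ : σ →₀ ℕ} (hγ : ∀ v, γ v < p ^ e)
    {F h : MvPolynomial σ K} (H : IsFrobeniusRoot p e γ F h) (g : MvPolynomial σ K)
    (δ : σ →₀ ℕ) : coeff (p ^ e • δ + γ) (g ^ p ^ e * F) = coeff δ (g * h) ^ p ^ e := by
  classical
  induction g using MvPolynomial.induction_on' with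
  | add f g hf hg =>
    rw [add_pow_char_pow, add_mul, coeff_add, hf, hg, add_mul, coeff_add, add_pow_char_pow]
  | monomial a b =>
    rw [monomial_pow, coeff_monomial_mul', coeff_monomial_mul']
    have hiff : p ^ e • a ≤ p ^ e • δ + γ ↔ a ≤ δ := by
      constructor
      · intro hle v
        have h1 := hle v
        have h2 := hγ v
        simp only [Finsupp.smul_apply, Finsupp.add_apply, smul_eq_mul] at h1
        by_contra! h3
        have : p ^ e * (δ v + 1) ≤ p ^ e * a v := Nat.mul_le_mul_left _ h3
        rw [mul_add, mul_one] at this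
        omega
      · intro hle v
        have := Nat.mul_le_mul_left (p ^ e) (hle v)
        simp only [Finsupp.smul_apply, Finsupp.add_apply, smul_eq_mul]
        omega
    by_cases hle : a ≤ δ
    · rw [if_pos hle, if_pos (hiff.2 hle), mul_pow, H]
      congr 2
      ext v
      have := Nat.mul_le_mul_left (p ^ e) (hle v)
      simp only [Finsupp.smul_apply, Finsupp.add_apply, smul_eq_mul, Finsupp.tsub_apply,
        Nat.mul_sub]
      omega
    · rw [if_neg hle, if_neg (fun h => hle (hiff.1 h)), zero_pow
        (pow_ne_zero _ (Fact.out : p.Prime).ne_zero)]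

end FrobeniusRoot

/-! ### Mixed powers and base-p digits of their exponents -/

section Reach

/-- The product `y ^ (p ^ e - 1) * ∏ f_j ^ i_j`. -/
noncomputable def mixedPower {σ ι R : Type*} [Fintype ι] [CommRing R] (p : ℕ)
    (y : MvPolynomial σ R) (f : ι → MvPolynomial σ R) (e : ℕ) (i : ι → ℕ) : MvPolynomial σ R :=
  y ^ (p ^ e - 1) * ∏ j, f j ^ i j

theorem map_mixedPower {σ ι R L : Type*} [Fintype ι] [CommRing R] [CommRing L] (p : ℕ)
    (y : MvPolynomial σ R) (f : ι → MvPolynomial σ R) (g : R →+* L) (e : ℕ) (i : ι → ℕ) :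
    map g (mixedPower p y f e i) = mixedPower p (map g y) (fun j => map g (f j)) e i := by
  simp [mixedPower, map_prod]

variable {σ ι K : Type*} [Fintype ι] [Field K] (p : ℕ)
  (y : MvPolynomial σ K) (f : ι → MvPolynomial σ K)

/-- `h` is a `p ^ e`-th root component of some mixed power of weight `r` whose exponents are
less than `p ^ e`. -/
def Reach (e r : ℕ) (h : MvPolynomial σ K) : Prop :=
  ∃ i : ι → ℕ, (∀ j, i j < p ^ e) ∧ ∑ j, i j = r ∧ ∃ γ : σ →₀ ℕ, (∀ v, γ v < p ^ e) ∧
    IsFrobeniusRoot p e γ (mixedPower p y f e i) h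

/-- The weights `r / p ^ e` of the reached polynomials outside of `X`. -/
def reachValues (X : Submodule K (MvPolynomial σ K)) : Set ℝ :=
  {x | ∃ e r h, Reach p y f e r h ∧ h ∉ X ∧ x = (r : ℝ) / (p : ℝ) ^ e}

variable {p} [Fact p.Prime] [CharP K p]

omit [CharP K p] in
theorem mixedPower_add (e : ℕ) (d i : ι → ℕ) :
    mixedPower p y f (e + 1) (fun j => p ^ e * d j + i j) =
      mixedPower p y f 1 d ^ p ^ e * mixedPower p y f e i := by
  have hp : 1 ≤ p := (Fact.out : p.Prime).one_le
  have hpe : 1 ≤ p ^ e := Nat.one_le_pow _ _ hp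
  have h1 : p ^ (e + 1) - 1 = (p ^ 1 - 1) * p ^ e + (p ^ e - 1) := by
    rw [Nat.sub_mul, pow_one, one_mul, ← pow_succ']
    have : p ^ e ≤ p ^ (e + 1) := Nat.pow_le_pow_right hp (Nat.le_succ e)
    omega
  simp only [mixedPower]
  rw [h1, pow_add, pow_mul, mul_pow, ← Finset.prod_pow]
  simp only [pow_add, Finset.prod_mul_distrib, mul_comm (p ^ e), pow_mul]
  ring

/-- One more `p`-th root prepends the leading base-`p` digits `d` and `β` to the exponents. On
normalized weights this is `x ↦ (|d| + x) / p`, the source of the self-similarity of thresholds. -/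
theorem Reach.succ {e r : ℕ} {h h' : MvPolynomial σ K} (H : Reach p y f e r h) {d : ι → ℕ}
    (hd : ∀ j, d j < p) {β : σ →₀ ℕ} (hβ : ∀ v, β v < p)
    (H' : IsFrobeniusRoot p 1 β (mixedPower p y f 1 d * h) h') :
    Reach p y f (e + 1) (r + p ^ e * ∑ j, d j) h' := by
  obtain ⟨i, hi, rfl, γ, hγ, hh⟩ := H
  have hlt : ∀ {a b : ℕ}, a < p → b < p ^ e → p ^ e * a + b < p ^ (e + 1) := fun {a b} ha hb => by
    have : p ^ e * (a + 1) ≤ p ^ e * p := Nat.mul_le_mul_left _ ha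
    rw [pow_succ]
    linarith
  refine ⟨fun j => p ^ e * d j + i j, fun j => hlt (hd j) (hi j), ?_, p ^ e • β + γ,
    fun v => ?_, fun δ => ?_⟩
  · rw [Finset.sum_add_distrib, Finset.mul_sum, add_comm]
  · simpa using hlt (hβ v) (hγ v)
  · rw [mixedPower_add, pow_succ', pow_mul, ← pow_one p, H' δ, pow_one,
      ← coeff_pow_mul_of_isFrobeniusRoot hγ hh]
    congr 1
    rw [smul_add, smul_smul, add_assoc, mul_comm]

/-- Division with remainder by `p^e` splits off the leading digits; a perfect field is needed for
the intermediate root to exist. -/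
theorem Reach.exists_of_succ [PerfectRing K p] {e r : ℕ} {h' : MvPolynomial σ K}
    (H : Reach p y f (e + 1) r h') :
    ∃ d : ι → ℕ, (∀ j, d j < p) ∧ ∃ β : σ →₀ ℕ, (∀ v, β v < p) ∧ ∃ r₀ h, Reach p y f e r₀ h ∧
      r = r₀ + p ^ e * ∑ j, d j ∧ IsFrobeniusRoot p 1 β (mixedPower p y f 1 d * h) h' := by
  obtain ⟨i, hi, rfl, γ, hγ, hh⟩ := H
  have hp : 0 < p ^ e := pow_pos (Fact.out : p.Prime).pos e
  set i₀ : ι → ℕ := fun j => i j % p ^ e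
  set d : ι → ℕ := fun j => i j / p ^ e
  have hid : i = fun j => p ^ e * d j + i₀ j := funext fun j => (Nat.div_add_mod _ _).symm
  set γ₀ : σ →₀ ℕ := γ.mapRange (fun a => a % p ^ e) (Nat.zero_mod _)
  set β : σ →₀ ℕ := γ.mapRange (fun a => a / p ^ e) (Nat.zero_div _)
  have hγβ : γ = p ^ e • β + γ₀ := by
    ext v
    simpa [β, γ₀] using (Nat.div_add_mod _ _).symm
  have hγ₀ : ∀ v, γ₀ v < p ^ e := fun v => by simpa [γ₀] using Nat.mod_lt _ hp
  obtain ⟨h, hroot⟩ := exists_isFrobeniusRoot e γ₀ (mixedPower p y f e i₀)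
  refine ⟨d, fun j => Nat.div_lt_of_lt_mul ?_, β, fun v => ?_, ∑ j, i₀ j, h,
    ⟨i₀, fun j => Nat.mod_lt _ hp, rfl, γ₀, hγ₀, hroot⟩, ?_, fun δ => ?_⟩
  · rw [← pow_succ]; exact hi j
  · simp only [β, Finsupp.mapRange_apply]
    refine Nat.div_lt_of_lt_mul ?_
    rw [← pow_succ]; exact hγ v
  · rw [hid, Finset.sum_add_distrib, Finset.mul_sum, add_comm]
  · apply pow_char_pow_injective (p := p) K e
    have := hh δ
    rw [hid, mixedPower_add, hγβ] at this
    simp only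
    rw [pow_one, ← pow_mul, ← pow_succ', this, ← coeff_pow_mul_of_isFrobeniusRoot hγ₀ hroot]
    congr 1
    rw [smul_add, smul_smul, add_assoc, pow_succ]

end Reach

end FThreshold

namespace FThreshold

/-! ### Finiteness of the set of possible thresholds -/

open MvPolynomial

section Finiteness

variable {σ ι K : Type*} [Finite σ] [Fintype ι] [Field K] {p : ℕ} [Fact p.Prime] [CharP K p]
  {y : MvPolynomial σ K} {f : ι → MvPolynomial σ K}

/-- The number of monomials of degree at most `M`. -/
noncomputable def monomialCount (σ : Type*) (M : ℕ) : ℕ :=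
  Nat.card {n : σ →₀ ℕ | (n.sum fun _ a => a) ≤ M}

-- A mixed power has degree at most `p^e M`, and a `p^e`-th root divides degrees by `p^e`. Hence the
-- bound does not depend on `e`.
omit [Finite σ] [CharP K p] in
theorem Reach.totalDegree_le {M : ℕ} (hM : y.totalDegree + ∑ j, (f j).totalDegree ≤ M)
    {e r : ℕ} {h : MvPolynomial σ K} (H : Reach p y f e r h) : h.totalDegree ≤ M := by
  obtain ⟨i, hi, -, γ, -, hroot⟩ := H
  have hq : 0 < p ^ e := pow_pos (Fact.out : p.Prime).pos e
  have hdeg : (mixedPower p y f e i).totalDegree ≤ p ^ e * M := by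
    calc (mixedPower p y f e i).totalDegree
        ≤ (y ^ (p ^ e - 1)).totalDegree + (∏ j, f j ^ i j).totalDegree := totalDegree_mul _ _
      _ ≤ (p ^ e - 1) * y.totalDegree + ∑ j, i j * (f j).totalDegree := by
          refine add_le_add (totalDegree_pow _ _) ((totalDegree_finsetProd _ _).trans ?_)
          exact Finset.sum_le_sum fun j _ => totalDegree_pow _ _
      _ ≤ p ^ e * y.totalDegree + ∑ j, p ^ e * (f j).totalDegree := by
          refine add_le_add (Nat.mul_le_mul_right _ (Nat.sub_le _ _)) ?_
          exact Finset.sum_le_sum fun j _ => Nat.mul_le_mul_right _ (hi j).le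
      _ ≤ p ^ e * M := by
          rw [← Finset.mul_sum, ← mul_add]
          exact Nat.mul_le_mul_left _ hM
  rw [totalDegree, Finset.sup_le_iff]
  intro δ hδ
  have h1 : coeff (p ^ e • δ + γ) (mixedPower p y f e i) ≠ 0 := by
    rw [← hroot δ]
    exact pow_ne_zero _ (mem_support_iff.1 hδ)
  have h2 := (le_totalDegree (mem_support_iff.2 h1)).trans hdeg
  change (p ^ e • δ + γ).degree ≤ _ at h2
  rw [map_add, map_nsmul, smul_eq_mul] at h2
  exact Nat.le_of_mul_le_mul_left ((Nat.le_add_right _ _).trans h2) hq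

variable (p y f) in
/-- The suprema of the sets `reachValues p y f X`. -/
def thresholdValues : Set ℝ :=
  {v | ∃ X : Submodule K (MvPolynomial σ K), IsLUB (reachValues p y f X) v}

variable (p y f) in
/-- The span of the reached polynomials of weight larger than `v`. -/
noncomputable def reachSpan (v : ℝ) : Submodule K (MvPolynomial σ K) :=
  Submodule.span K {h | ∃ e r, Reach p y f e r h ∧ v < (r : ℝ) / (p : ℝ) ^ e}

-- As `v'` is a supremum for `X`, some reached polynomial of weight above `v` lies outside `X`,
-- whereas every one of weight above `v'` lies inside. Thus each threshold costs a dimension in a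
-- space of polynomials of bounded degree.
omit [Finite σ] [Fact p.Prime] [CharP K p] in
theorem reachSpan_lt {v v' : ℝ} (hv' : v' ∈ thresholdValues p y f) (h : v < v') :
    reachSpan p y f v' < reachSpan p y f v := by
  obtain ⟨X, hX⟩ := hv'
  refine lt_of_le_of_ne (Submodule.span_mono ?_) fun heq => ?_
  · rintro g ⟨e, r, hg, hlt⟩
    exact ⟨e, r, hg, h.trans hlt⟩
  · obtain ⟨_, ⟨e, r, g, hg, hgX, rfl⟩, hlt, -⟩ := hX.exists_between h
    have hmem : g ∈ reachSpan p y f v' := heq ▸ Submodule.subset_span ⟨e, r, hg, hlt⟩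
    refine hgX ((Submodule.span_le (p := X)).2 ?_ hmem)
    rintro g' ⟨e', r', hg', hlt'⟩
    by_contra hgX'
    exact (hX.1 ⟨e', r', g', hg', hgX', rfl⟩).not_gt hlt'

omit [CharP K p] in
theorem thresholdValues_encard_le {M : ℕ} (hM : y.totalDegree + ∑ j, (f j).totalDegree ≤ M) :
    (thresholdValues p y f).encard ≤ monomialCount σ M + 1 := by
  have hle : ∀ v, reachSpan p y f v ≤ restrictTotalDegree σ K M := fun v => by
    refine Submodule.span_le.2 ?_
    rintro g ⟨e, r, hg, -⟩
    exact (mem_restrictTotalDegree _ _ _).2 (hg.totalDegree_le hM)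
  have hcount : Module.finrank K (restrictTotalDegree σ K M) = monomialCount σ M :=
    Module.finrank_eq_nat_card_basis (basisRestrictSupport K _)
  have hfin : ∀ v, Module.Finite K (reachSpan p y f v) := fun v =>
    Submodule.finiteDimensional_of_le (hle v)
  have hmaps : Set.MapsTo (fun v => Module.finrank K (reachSpan p y f v)) (thresholdValues p y f)
      (Set.Iio (monomialCount σ M + 1)) := fun v _ => by
    rw [Set.mem_Iio, Nat.lt_succ_iff, ← hcount]
    exact Submodule.finrank_mono (hle v)
  have hinj : Set.InjOn (fun v => Module.finrank K (reachSpan p y f v))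
      (thresholdValues p y f) := by
    intro v hv v' hv' heq
    by_contra hne
    rcases lt_or_gt_of_ne hne with h | h
    · exact (Submodule.finrank_lt_finrank_of_lt (reachSpan_lt hv' h)).ne' heq
    · exact (Submodule.finrank_lt_finrank_of_lt (reachSpan_lt hv h)).ne heq
  refine (Set.encard_le_encard_of_injOn hmaps hinj).trans ?_
  rw [← Finset.coe_Iio, Set.encard_coe_eq_coe_finsetCard]
  simp

variable (p y f) in
/-- The subspace of the `h` all of whose root components after multiplication with
`y ^ (p - 1) * ∏ f_j ^ d_j` lie in `X`. -/
def rootColon [PerfectRing K p] (d : ι → ℕ) (X : Submodule K (MvPolynomial σ K)) :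
    Submodule K (MvPolynomial σ K) where
  carrier := {h | ∀ β : σ →₀ ℕ, (∀ v, β v < p) → ∀ h',
    IsFrobeniusRoot p 1 β (mixedPower p y f 1 d * h) h' → h' ∈ X}
  zero_mem' := fun β hβ h' hh' => by
    have : h' = 0 := hh'.unique fun δ => by simp [(Fact.out : p.Prime).ne_zero]
    exact this ▸ X.zero_mem
  add_mem' := fun {a b} ha hb β hβ h' hh' => by
    obtain ⟨a', ha'⟩ := exists_isFrobeniusRoot 1 β (mixedPower p y f 1 d * a)
    obtain ⟨b', hb'⟩ := exists_isFrobeniusRoot 1 β (mixedPower p y f 1 d * b)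
    rw [mul_add] at hh'
    rw [hh'.unique (ha'.add hb')]
    exact X.add_mem (ha β hβ _ ha') (hb β hβ _ hb')
  smul_mem' := fun c a ha β hβ h' hh' => by
    obtain ⟨a', ha'⟩ := exists_isFrobeniusRoot 1 β (mixedPower p y f 1 d * a)
    -- Writing `c = b^p`, multiplication by `c` becomes multiplication by `b` on root components.
    obtain ⟨b, hb⟩ := (PerfectRing.bijective_frobenius (R := K) (p := p)).2 c
    have h1 := ha'.C_mul b
    rw [show c = b ^ p ^ 1 by rw [pow_one]; exact hb.symm, smul_eq_C_mul,
      mul_left_comm] at hh'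
    rw [hh'.unique h1, ← smul_eq_C_mul]
    exact X.smul_mem _ (ha β hβ _ ha')

theorem isLUB_of_finite_cover {D : Type*} [Finite D] {s : D → Set ℝ} {T : Set ℝ} {v : ℝ}
    (hT : IsLUB T v) (hne : T.Nonempty) (hsT : ∀ d, ∀ x ∈ s d, x ≤ v)
    (hcover : ∀ x ∈ T, ∃ d, x ∈ s d) : ∃ d, IsLUB (s d) v := by
  by_contra! hcon
  have hb : ∀ d, ∃ b < v, ∀ x ∈ s d, x ≤ b := fun d => by
    by_contra! hb
    refine hcon d ⟨hsT d, fun b hbu => ?_⟩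
    by_contra! hlt
    obtain ⟨x, hx, hbx⟩ := hb b hlt
    exact (hbu hx).not_gt hbx
  choose b hbv hbs using hb
  obtain ⟨x₀, hx₀⟩ := hne
  obtain ⟨d₀, -⟩ := hcover x₀ hx₀
  have : Nonempty D := ⟨d₀⟩
  obtain ⟨dm, hdm⟩ := Finite.exists_max b
  refine (hbv dm).not_ge (hT.2 fun x hx => ?_)
  obtain ⟨d, hd⟩ := hcover x hx
  exact (hbs d x hd).trans (hdm d)

-- Sorted by leading digits `d`, the positive values for `X` are covered by finitely many affine
-- images, under `x ↦ (|d| + x) / p`, of the values for `rootColon d X`. One of these images has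
-- supremum `v`, so `p v - |d|` is the threshold of that `rootColon`.
omit [Finite σ] in
theorem exists_mul_sub_mem_thresholdValues [PerfectRing K p] {v : ℝ}
    (hv : v ∈ thresholdValues p y f) (hv0 : v ≠ 0) :
    ∃ d : ℕ, p * v - d ∈ thresholdValues p y f := by
  obtain ⟨X, hX⟩ := hv
  have hp : (0 : ℝ) < p := by exact_mod_cast (Fact.out : p.Prime).pos
  have hne : (reachValues p y f X).Nonempty := hX.nonempty
  have hnonneg : ∀ x ∈ reachValues p y f X, 0 ≤ x := by
    rintro _ ⟨e, r, h, -, -, rfl⟩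
    positivity
  have hvpos : 0 < v := by
    obtain ⟨x, hx⟩ := hne
    exact lt_of_le_of_ne ((hnonneg x hx).trans (hX.1 hx)) hv0.symm
  set s : (ι → Fin p) → Set ℝ := fun d =>
    (fun x => ((∑ j, (d j : ℕ) : ℕ) + x) / (p : ℝ)) ''
      reachValues p y f (rootColon p y f (fun j => d j) X) with hs
  -- The value `0` is removed because level `e = 0` has no digit to split off; since `v > 0` the
  -- supremum is unchanged.
  have hLUB : IsLUB (reachValues p y f X ∩ Set.Ioi 0) v := by
    refine ⟨fun x hx => hX.1 hx.1, fun b hb => ?_⟩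
    by_contra! hlt
    obtain ⟨x, hx, hbx, -⟩ := hX.exists_between (max_lt hlt hvpos)
    exact (hb ⟨hx, (le_max_right _ _).trans_lt hbx⟩).not_gt ((le_max_left _ _).trans_lt hbx)
  have hsv : ∀ d, ∀ x ∈ s d, x ≤ v := by
    rintro d _ ⟨_, ⟨e, r, h, hh, hhX, rfl⟩, rfl⟩
    refine hX.1 ?_
    have hhX' : ∃ β : σ →₀ ℕ, (∀ v, β v < p) ∧ ∃ h',
        IsFrobeniusRoot p 1 β (mixedPower p y f 1 (fun j => (d j : ℕ)) * h) h' ∧ h' ∉ X := by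
      by_contra! hcon
      exact hhX hcon
    obtain ⟨β, hβ, h', hh', hh'X⟩ := hhX'
    refine ⟨e + 1, _, h', hh.succ y f (fun j => (d j).2) hβ hh', hh'X, ?_⟩
    push_cast
    field_simp
    ring
  have hcover : ∀ x ∈ reachValues p y f X ∩ Set.Ioi 0, ∃ d, x ∈ s d := by
    rintro _ ⟨⟨e, r, h', hh', hhX, rfl⟩, hpos⟩
    rcases e with _ | e
    · obtain ⟨i, hi, rfl, -⟩ := hh'
      have : ∀ j, i j = 0 := fun j => by simpa using hi j
      simp [this] at hpos
    · obtain ⟨d, hd, β, hβ, r₀, h, hh, rfl, hroot⟩ := hh'.exists_of_succ y f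
      refine ⟨fun j => ⟨d j, hd j⟩, _, ⟨e, r₀, h, hh, fun hcon => hhX (hcon β hβ h' hroot), rfl⟩, ?_⟩
      push_cast
      field_simp
      ring
  obtain ⟨d, hd⟩ := isLUB_of_finite_cover hLUB hLUB.nonempty hsv hcover
  refine ⟨∑ j, (d j : ℕ), rootColon p y f (fun j => d j) X, ?_, ?_⟩
  · intro x hx
    have := hd.1 ⟨x, hx, rfl⟩
    rw [div_le_iff₀ hp] at this
    linarith
  · intro b hb
    have : v ≤ ((∑ j, (d j : ℕ) : ℕ) + b) / p := by
      refine hd.2 ?_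
      rintro _ ⟨x, hx, rfl⟩
      exact div_le_div_of_nonneg_right (by linarith [hb hx]) hp.le
    rw [le_div_iff₀ hp] at this
    linarith

/-- Iterating `v ↦ p v - d` stays in a finite set and gives `p^n v` modulo integers, so two iterates
coincide. -/
theorem exists_pow_sub_pow_mul_eq_int [PerfectRing K p] {M : ℕ}
    (hM : y.totalDegree + ∑ j, (f j).totalDegree ≤ M) {v : ℝ}
    (hv : v ∈ thresholdValues p y f) :
    ∃ i i' : ℕ, i < i' ∧ i' ≤ monomialCount σ M + 2 ∧
      ∃ z : ℤ, ((p : ℝ) ^ i' - (p : ℝ) ^ i) * v = z := by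
  -- Zero is added as a fixed point, because the step `v ↦ p v - d` is only available for nonzero
  -- thresholds.
  set F : Set ℝ := insert 0 (thresholdValues p y f)
  have hF : F.encard ≤ monomialCount σ M + 1 + 1 :=
    (Set.encard_insert_le _ _).trans (by gcongr; exact thresholdValues_encard_le hM)
  have hstep : ∀ x : F, ∃ x' : F, ∃ d : ℕ, (x' : ℝ) = p * x - d := by
    rintro ⟨x, hx⟩
    by_cases hx0 : x = 0
    · exact ⟨⟨x, hx⟩, 0, by simp [hx0]⟩
    · obtain ⟨d, hd⟩ := exists_mul_sub_mem_thresholdValues (hx.resolve_left hx0) hx0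
      exact ⟨⟨_, Or.inr hd⟩, d, rfl⟩
  choose T hT using hstep
  set u : ℕ → F := fun n => T^[n] ⟨v, Or.inr hv⟩ with hu
  have hint : ∀ n, ∃ z : ℤ, (p : ℝ) ^ n * v - u n = z := fun n => by
    induction n with
    | zero => exact ⟨0, by simp [hu]⟩
    | succ n ih =>
      obtain ⟨z, hz⟩ := ih
      obtain ⟨d, hd⟩ := hT (u n)
      refine ⟨p * z + d, ?_⟩
      have : u (n + 1) = T (u n) := Function.iterate_succ_apply' _ _ _
      rw [this, hd, pow_succ]
      push_cast
      rw [← hz]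
      ring
  have hmaps : Set.MapsTo (fun n => (u n : ℝ)) (Set.Iic (monomialCount σ M + 2)) F :=
    fun n _ => (u n).2
  -- There are `monomialCount σ M + 3` indices and at most `monomialCount σ M + 2` values.
  have hninj : ¬ Set.InjOn (fun n => (u n : ℝ)) (Set.Iic (monomialCount σ M + 2)) := fun hinj => by
    have h1 := (Set.encard_le_encard_of_injOn hmaps hinj).trans hF
    rw [← Finset.coe_Iic, Set.encard_coe_eq_coe_finsetCard, Nat.card_Iic] at h1
    have h2 : monomialCount σ M + 2 + 1 ≤ monomialCount σ M + 1 + 1 := by exact_mod_cast h1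
    omega
  simp only [Set.InjOn, Set.mem_Iic, not_forall] at hninj
  obtain ⟨i, hi, i', hi', heq, hne⟩ := hninj
  obtain ⟨z, hz⟩ := hint i
  obtain ⟨z', hz'⟩ := hint i'
  rcases lt_or_gt_of_ne hne with h | h
  · refine ⟨i, i', h, hi', z' - z, ?_⟩
    push_cast
    rw [← hz, ← hz', heq]
    ring
  · refine ⟨i', i, h, hi, z - z', ?_⟩
    push_cast
    rw [← hz, ← hz', heq]
    ring

/-- A finite set which contains all the thresholds of polynomials of bounded complexity. -/
def possibleThresholds (p l N : ℕ) : Set ℝ :=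
  {x | 0 ≤ x ∧ x ≤ l ∧ ∃ i i' : ℕ, i < i' ∧ i' ≤ N ∧ ∃ z : ℤ, ((p : ℝ) ^ i' - (p : ℝ) ^ i) * x = z}

omit [Fact p.Prime] in
theorem possibleThresholds_finite (hp : p.Prime) (l N : ℕ) : (possibleThresholds p l N).Finite := by
  have hsub : possibleThresholds p l N ⊆ ⋃ i ∈ Set.Iic N, ⋃ i' ∈ Set.Iic N,
      (fun z : ℤ => (z : ℝ) / ((p : ℝ) ^ i' - (p : ℝ) ^ i)) '' Set.Icc 0 (p ^ i' * l : ℤ) := by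
    rintro x ⟨hx0, hxl, i, i', hii', hi', z, hz⟩
    simp only [Set.mem_iUnion]
    have hlt : (p : ℝ) ^ i < (p : ℝ) ^ i' :=
      pow_lt_pow_right₀ (by exact_mod_cast hp.one_lt) hii'
    have hpos : (0 : ℝ) < (p : ℝ) ^ i := pow_pos (by exact_mod_cast hp.pos) i
    refine ⟨i, hii'.le.trans hi', i', hi', z, ⟨?_, ?_⟩, ?_⟩
    · have : (0 : ℝ) ≤ z := hz ▸ mul_nonneg (sub_pos.2 hlt).le hx0
      exact_mod_cast this
    · have : (z : ℝ) ≤ (p : ℝ) ^ i' * l := by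
        rw [← hz]
        exact mul_le_mul (by linarith) hxl hx0 (by positivity)
      exact_mod_cast this
    · simp only
      rw [← hz, mul_div_cancel_left₀ _ (sub_pos.2 hlt).ne']
  refine Set.Finite.subset ?_ hsub
  exact (Set.finite_Iic N).biUnion fun i _ => (Set.finite_Iic N).biUnion fun i' _ =>
    (Set.finite_Icc _ _).image _

variable (p y f) in
/-- The values `|i| / p ^ e` of the mixed powers which are not in `(x_v ^ (p ^ e))`. -/
def mixedValues : Set ℝ :=
  {x | ∃ (e : ℕ) (i : ι → ℕ) (γ : σ →₀ ℕ), (∀ j, i j < p ^ e) ∧ (∀ v, γ v < p ^ e) ∧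
    coeff γ (mixedPower p y f e i) ≠ 0 ∧ x = (∑ j, i j : ℕ) / (p : ℝ) ^ e}

-- The coefficient at `γ` is the `p^e`-th power of the constant term of the root component, so `X`
-- is the space of polynomials without constant term.
omit [Finite σ] in
theorem mixedValues_eq_reachValues [PerfectRing K p] :
    mixedValues p y f = reachValues p y f (LinearMap.ker (lcoeff K (0 : σ →₀ ℕ))) := by
  have hp : p ≠ 0 := (Fact.out : p.Prime).ne_zero
  ext x
  constructor
  · rintro ⟨e, i, γ, hi, hγ, hne, rfl⟩
    obtain ⟨h, hh⟩ := exists_isFrobeniusRoot e γ (mixedPower p y f e i)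
    refine ⟨e, _, h, ⟨i, hi, rfl, γ, hγ, hh⟩, fun hker => hne ?_, rfl⟩
    have := hh 0
    rw [smul_zero, zero_add] at this
    rw [← this, show coeff 0 h = 0 from hker, zero_pow (pow_ne_zero _ hp)]
  · rintro ⟨e, r, h, ⟨i, hi, rfl, γ, hγ, hh⟩, hker, rfl⟩
    refine ⟨e, i, γ, hi, hγ, fun h0 => hker ?_, rfl⟩
    have := hh 0
    rw [smul_zero, zero_add, h0] at this
    exact pow_eq_zero_iff (pow_ne_zero e hp) |>.1 this

omit [Finite σ] [CharP K p] in
theorem le_of_mem_mixedValues {x : ℝ} (hx : x ∈ mixedValues p y f) :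
    0 ≤ x ∧ x ≤ Fintype.card ι := by
  obtain ⟨e, i, γ, hi, -, -, rfl⟩ := hx
  have hp : (0 : ℝ) < (p : ℝ) ^ e := pow_pos (by exact_mod_cast (Fact.out : p.Prime).pos) e
  refine ⟨by positivity, ?_⟩
  rw [div_le_iff₀ hp]
  have : ∑ j, i j ≤ Fintype.card ι * p ^ e := by
    refine (Finset.sum_le_card_nsmul _ _ _ fun j _ => (hi j).le).trans ?_
    simp
  exact_mod_cast this

-- Field extensions preserve nonvanishing of coefficients; this permits passing to the perfect
-- closure.
omit [Finite σ] [CharP K p] [Fact p.Prime] in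
theorem mixedValues_map {L : Type*} [Field L] (g : K →+* L) :
    mixedValues p (map g y) (fun j => map g (f j)) = mixedValues p y f := by
  ext x
  simp only [mixedValues, ← map_mixedPower, coeff_map, map_ne_zero]

theorem mem_possibleThresholds {M : ℕ} (hM : y.totalDegree + ∑ j, (f j).totalDegree ≤ M) {v : ℝ}
    (hv : IsLUB (mixedValues p y f) v) :
    v ∈ possibleThresholds p (Fintype.card ι) (monomialCount σ M + 2) := by
  obtain ⟨x, hx⟩ := hv.nonempty
  refine ⟨(le_of_mem_mixedValues hx).1.trans (hv.1 hx),
    hv.2 fun x hx => (le_of_mem_mixedValues hx).2, ?_⟩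
  rw [← mixedValues_map (PerfectClosure.of K p), mixedValues_eq_reachValues] at hv
  refine exists_pow_sub_pow_mul_eq_int
    (le_trans (add_le_add ?_ (Finset.sum_le_sum fun j _ => ?_)) hM) ⟨_, hv⟩
  · exact Finset.sup_mono (support_map_subset _ _)
  · exact Finset.sup_mono (support_map_subset _ _)

end Finiteness

end FThreshold

namespace FThreshold

/-! ### The ideals of q-th powers of the variables and their duality -/

open MvPolynomial

section MonomialIdeal

variable {σ K : Type*} [Fintype σ] [Field K]

variable (σ K) in
/-- The ideal generated by the `q`-th powers of the variables. -/
noncomputable def varPowIdeal (q : ℕ) : Ideal (MvPolynomial σ K) :=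
  Ideal.span (Set.range fun v => X v ^ q)

variable (σ) in
/-- The exponent all of whose entries are `q - 1`. -/
noncomputable def topExponent (q : ℕ) : σ →₀ ℕ :=
  Finsupp.equivFunOnFinite.symm fun _ => q - 1

@[simp] theorem topExponent_apply (q : ℕ) (v : σ) : topExponent σ q v = q - 1 := rfl

omit [Fintype σ] in
theorem mem_varPowIdeal_iff {q : ℕ} {f : MvPolynomial σ K} :
    f ∈ varPowIdeal σ K q ↔ ∀ γ : σ →₀ ℕ, (∀ v, γ v < q) → coeff γ f = 0 := by
  have h : varPowIdeal σ K q = Ideal.span ((fun s => monomial s (1 : K)) ''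
      Set.range fun v => Finsupp.single v q) := by
    rw [varPowIdeal, ← Set.range_comp]
    congr 2
    ext1 v
    simp [X_pow_eq_monomial]
  rw [h, mem_ideal_span_monomial_image]
  constructor
  · intro H γ hγ
    by_contra hne
    obtain ⟨_, ⟨v, rfl⟩, hle⟩ := H γ (mem_support_iff.2 hne)
    have := hle v
    simp only [Finsupp.single_eq_same] at this
    exact (hγ v).not_ge this
  · intro H γ hγ
    by_contra! hcon
    refine mem_support_iff.1 hγ (H γ fun v => ?_)
    have := hcon _ ⟨v, rfl⟩
    rwa [Finsupp.single_le_iff, not_le] at this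

/-- Multiplication by `x^((Q-1)q)` shifts the box of exponents below `q` into the box of exponents
below `Q q`. -/
theorem pow_mul_mem_varPowIdeal {q Q : ℕ} (hQ : 0 < Q) {c : MvPolynomial σ K}
    (h : c * monomial (topExponent σ Q) 1 ^ q ∈ varPowIdeal σ K (Q * q)) :
    c ∈ varPowIdeal σ K q := by
  rw [mem_varPowIdeal_iff] at h ⊢
  intro γ hγ
  have := h (γ + q • topExponent σ Q) fun v => ?_
  · rwa [monomial_pow, one_pow, coeff_mul_monomial, mul_one] at this
  · have h1 := hγ v
    obtain ⟨Q, rfl⟩ := Nat.exists_eq_succ_of_ne_zero hQ.ne'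
    simp only [Finsupp.add_apply, Finsupp.smul_apply, topExponent_apply, smul_eq_mul,
      Nat.succ_eq_add_one, Nat.add_sub_cancel]
    linarith [mul_comm q Q]

theorem le_topExponent_iff {q : ℕ} (hq : 0 < q) {γ : σ →₀ ℕ} :
    γ ≤ topExponent σ q ↔ ∀ v, γ v < q := by
  rw [Finsupp.le_def]
  exact forall_congr' fun v => by rw [topExponent_apply]; omega

/-- An element outside `(x_v ^ q)` has a multiple congruent to the socle generator. -/
theorem exists_mul_sub_topMonomial_mem {q : ℕ} (hq : 0 < q) {g : MvPolynomial σ K}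
    (hg : g ∉ varPowIdeal σ K q) :
    ∃ w, w * g - monomial (topExponent σ q) 1 ∈ varPowIdeal σ K q := by
  classical
  rw [mem_varPowIdeal_iff] at hg
  push Not at hg
  obtain ⟨γ₀, hγ₀, hne₀⟩ := hg
  -- For a minimal exponent `γ` of `g` in the box, multiplication by `x^(top - γ)` pushes every
  -- other term of `g` out of the box.
  obtain ⟨γ, ⟨hγ, hne⟩, hmin⟩ := WellFounded.has_min (wellFounded_lt (α := σ →₀ ℕ))
    {γ | (∀ v, γ v < q) ∧ coeff γ g ≠ 0} ⟨γ₀, hγ₀, hne₀⟩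
  have hγt := (le_topExponent_iff hq).2 hγ
  refine ⟨monomial (topExponent σ q - γ) (coeff γ g)⁻¹, ?_⟩
  rw [mem_varPowIdeal_iff]
  intro δ hδ
  have hδt := (le_topExponent_iff hq).2 hδ
  rw [coeff_sub, coeff_monomial_mul', coeff_monomial]
  split_ifs with h1 h2 h2
  · subst h2
    rw [tsub_tsub_cancel_of_le hγt, inv_mul_cancel₀ hne, sub_self]
  · have hlt : δ - (topExponent σ q - γ) < γ := by
      refine lt_of_le_of_ne (fun v => ?_) fun heq => h2 ?_
      · have h3 := hδt v
        have h4 := hγt v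
        simp only [Finsupp.tsub_apply, topExponent_apply] at h3 h4 ⊢
        omega
      · ext v
        have h3 := DFunLike.congr_fun heq v
        have h4 := hγt v
        have h5 := h1 v
        simp only [Finsupp.tsub_apply, topExponent_apply] at h3 h4 h5 ⊢
        omega
    have h0 : coeff (δ - (topExponent σ q - γ)) g = 0 := by
      by_contra hne'
      exact hmin _ ⟨fun v => (hlt.le v).trans_lt (hγ v), hne'⟩ hlt
    rw [h0, mul_zero, sub_zero]
  · exact absurd (h2 ▸ tsub_le_self) h1
  · rw [sub_zero]

theorem sub_truncation_mem_varPowIdeal [DecidableEq σ] {q : ℕ} (hq : 0 < q)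
    (f : MvPolynomial σ K) :
    f - ∑ γ ∈ Finset.Icc 0 (topExponent σ q), monomial γ (coeff γ f) ∈ varPowIdeal σ K q := by
  rw [mem_varPowIdeal_iff]
  intro γ hγ
  have : γ ∈ Finset.Icc 0 (topExponent σ q) :=
    Finset.mem_Icc.2 ⟨zero_le, (le_topExponent_iff hq).2 hγ⟩
  rw [coeff_sub, coeff_sum]
  simp only [coeff_monomial]
  rw [Finset.sum_ite_eq' _ γ, if_pos this, sub_self]

/-- Self-duality of `K[x] / (x_v ^ q)`. -/
theorem exists_mul_mem_varPowIdeal {q : ℕ} (hq : 0 < q) {I : Ideal (MvPolynomial σ K)}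
    (hI : varPowIdeal σ K q ≤ I) {z : MvPolynomial σ K} (hz : z ∉ I) :
    ∃ w, (∀ u ∈ I, w * u ∈ varPowIdeal σ K q) ∧
      w * z - monomial (topExponent σ q) 1 ∈ varPowIdeal σ K q := by
  classical
  -- A functional vanishing on `I` but not at `z` is represented, through the coefficient of the
  -- socle monomial, by multiplication with `w`.
  obtain ⟨ℓ, hℓz, hℓ⟩ := Submodule.exists_le_ker_of_notMem (p := I.restrictScalars K) hz
  set w : MvPolynomial σ K := ∑ γ ∈ Finset.Icc 0 (topExponent σ q),
    monomial (topExponent σ q - γ) (ℓ (monomial γ 1)) with hw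
  have hcoeff : ∀ f : MvPolynomial σ K, coeff (topExponent σ q) (w * f) = ℓ f := fun f => by
    have h1 : ℓ f = ∑ γ ∈ Finset.Icc 0 (topExponent σ q), ℓ (monomial γ (coeff γ f)) := by
      rw [← map_sum, ← sub_eq_zero, ← map_sub]
      exact hℓ (hI (sub_truncation_mem_varPowIdeal hq f))
    rw [h1, hw, Finset.sum_mul, coeff_sum]
    refine Finset.sum_congr rfl fun γ hγ => ?_
    rw [coeff_monomial_mul', if_pos tsub_le_self,
      tsub_tsub_cancel_of_le (Finset.mem_Icc.1 hγ).2, mul_comm]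
    rw [show monomial γ (coeff γ f) = coeff γ f • monomial γ (1 : K) by
      rw [smul_monomial, smul_eq_mul, mul_one], map_smul, smul_eq_mul]
  have hwI : ∀ u ∈ I, w * u ∈ varPowIdeal σ K q := fun u hu => by
    rw [mem_varPowIdeal_iff]
    intro γ hγ
    have hγt := (le_topExponent_iff hq).2 hγ
    have h1 := hcoeff (u * monomial (topExponent σ q - γ) 1)
    rw [show ℓ (u * monomial (topExponent σ q - γ) 1) = 0 from hℓ (I.mul_mem_right _ hu),
      ← mul_assoc, coeff_mul_monomial', if_pos tsub_le_self,
      tsub_tsub_cancel_of_le hγt, mul_one] at h1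
    exact h1
  have hwz : w * z ∉ varPowIdeal σ K q := fun h => by
    refine hℓz ?_
    rw [← hcoeff z]
    exact mem_varPowIdeal_iff.1 h _ ((le_topExponent_iff hq).1 le_rfl)
  obtain ⟨w', hw'⟩ := exists_mul_sub_topMonomial_mem hq hwz
  refine ⟨w' * w, fun u hu => ?_, by rwa [mul_assoc]⟩
  rw [mul_assoc]
  exact Ideal.mul_mem_left _ _ (hwI u hu)

theorem exists_idealOfVars_pow_le_varPowIdeal (q : ℕ) :
    ∃ N, idealOfVars σ K ^ N ≤ varPowIdeal σ K q := by
  refine ⟨Fintype.card σ * q + 1, fun f hf => mem_varPowIdeal_iff.2 fun γ hγ => ?_⟩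
  refine (mem_pow_idealOfVars_iff' _ _).1 hf γ ?_
  rw [Finsupp.degree_eq_sum, Nat.lt_succ_iff]
  refine (Finset.sum_le_card_nsmul _ _ _ fun v _ => (hγ v).le).trans ?_
  simp

omit [Fintype σ] in
theorem mem_idealOfVars_iff {f : MvPolynomial σ K} :
    f ∈ idealOfVars σ K ↔ constantCoeff f = 0 := by
  rw [← pow_one (idealOfVars σ K), mem_pow_idealOfVars_iff']
  simp only [Nat.lt_one_iff, Finsupp.degree_eq_zero_iff, forall_eq]
  rfl

variable (p : ℕ) [Fact p.Prime] [CharP K p]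

omit [Fintype σ] in
theorem varPowIdeal_eq_frobeniusPower (e : ℕ) :
    varPowIdeal σ K (p ^ e) = frobeniusPower (idealOfVars σ K) (p ^ e) := by
  rw [idealOfVars, frobeniusPower_span, varPowIdeal, ← Set.range_comp]
  rfl

variable {p}

omit [Fintype σ] in
theorem pow_mem_varPowIdeal {f : MvPolynomial σ K} (hf : constantCoeff f = 0) (e : ℕ) :
    f ^ p ^ e ∈ varPowIdeal σ K (p ^ e) := by
  rw [varPowIdeal_eq_frobeniusPower]
  exact pow_mem_frobeniusPower (mem_idealOfVars_iff.2 hf) _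

omit [Fintype σ] in
theorem pow_mem_varPowIdeal_of_mem {f : MvPolynomial σ K} {e : ℕ}
    (hf : f ∈ varPowIdeal σ K (p ^ e)) (e' : ℕ) :
    f ^ p ^ e' ∈ varPowIdeal σ K (p ^ (e + e')) := by
  rw [varPowIdeal_eq_frobeniusPower] at hf ⊢
  rw [← frobeniusPower_frobeniusPower]
  exact pow_mem_frobeniusPower hf _

end MonomialIdeal

/-! ### Changes of coordinates at the origin -/

section Coordinates

variable {σ K : Type*} [Fintype σ] [DecidableEq σ] [Field K]

/-- The Jacobian matrix at the origin. -/
noncomputable def jacobianMatrix {R : Type*} [CommRing R] (Y : σ → MvPolynomial σ R) : Matrix σ σ R :=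
  fun u v => coeff (Finsupp.single v 1) (Y u)

theorem sub_linear_mem_idealOfVars_sq {f : MvPolynomial σ K} (hf : constantCoeff f = 0) :
    f - ∑ v, C (coeff (Finsupp.single v 1) f) * X v ∈ idealOfVars σ K ^ 2 := by
  rw [mem_pow_idealOfVars_iff']
  intro γ hγ
  rw [coeff_sub, coeff_sum]
  simp only [coeff_C_mul, coeff_X, mul_ite, mul_one, mul_zero]
  rcases Nat.lt_succ_iff_lt_or_eq.1 hγ with h | h
  · rw [Nat.lt_one_iff, Finsupp.degree_eq_zero_iff] at h
    subst h
    rw [Finset.sum_eq_zero fun v _ => if_neg (by simp), sub_zero]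
    exact hf
  · obtain ⟨u, rfl⟩ : γ ∈ Set.range fun u => Finsupp.single u 1 := by
      rw [Finsupp.range_single_one]
      exact h
    rw [Finset.sum_eq_single u]
    · simp
    · intro v _ hvu
      exact if_neg fun h => hvu (Finsupp.single_left_injective one_ne_zero h)
    · simp

variable {Y : σ → MvPolynomial σ K}

/-- The inverse Jacobian matrix turns the linear parts of the `Y_u` into the variables. -/
theorem exists_span_range_sub_mem (hY : ∀ u, constantCoeff (Y u) = 0)
    (hdet : (jacobianMatrix Y).det ≠ 0) :
    ∃ l : σ → MvPolynomial σ K, (∀ v, l v ∈ Submodule.span K (Set.range Y)) ∧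
      ∀ v, X v - l v ∈ idealOfVars σ K ^ 2 := by
  set N := (jacobianMatrix Y)⁻¹
  have hN : N * jacobianMatrix Y = 1 := Matrix.nonsing_inv_mul _ (isUnit_iff_ne_zero.2 hdet)
  refine ⟨fun v => ∑ u, N v u • Y u, fun v => ?_, fun v => ?_⟩
  · exact Submodule.sum_mem _ fun u _ => Submodule.smul_mem _ _ (Submodule.subset_span ⟨u, rfl⟩)
  · have h1 : ∑ u, N v u • (Y u - ∑ w, C (coeff (Finsupp.single w 1) (Y u)) * X w) ∈
        idealOfVars σ K ^ 2 :=
      Ideal.sum_mem _ fun u _ => by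
        rw [smul_eq_C_mul]
        exact Ideal.mul_mem_left _ _ (sub_linear_mem_idealOfVars_sq (hY u))
    have h2 : ∑ u, N v u • ∑ w, C (coeff (Finsupp.single w 1) (Y u)) * X w = X v := by
      simp only [Finset.smul_sum]
      rw [Finset.sum_comm]
      have : ∀ w, ∑ u, N v u • (C (coeff (Finsupp.single w 1) (Y u)) * X w : MvPolynomial σ K) =
          C ((1 : Matrix σ σ K) v w) * X w := fun w => by
        rw [← hN, Matrix.mul_apply, map_sum, Finset.sum_mul]
        refine Finset.sum_congr rfl fun u _ => ?_
        rw [smul_eq_C_mul, ← mul_assoc, ← C_mul]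
        rfl
      simp only [this, Matrix.one_apply]
      rw [Finset.sum_eq_single v]
      · simp
      · intro w _ hwv
        simp [hwv.symm]
      · simp
    simp only [smul_sub, Finset.sum_sub_distrib, h2] at h1
    rw [← neg_sub]
    exact neg_mem h1

-- A substitution tangent to the identity acts trivially on the associated graded ring.
omit [Fintype σ] [DecidableEq σ] in
theorem sub_aeval_mem {l : σ → MvPolynomial σ K} (hl : ∀ v, X v - l v ∈ idealOfVars σ K ^ 2)
    (k : ℕ) {f : MvPolynomial σ K} (hf : f ∈ idealOfVars σ K ^ k) :
    f - aeval l f ∈ idealOfVars σ K ^ (k + 1) := by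
  have hX : ∀ v, X v ∈ idealOfVars σ K := fun v => Ideal.subset_span ⟨v, rfl⟩
  have h0 : ∀ f : MvPolynomial σ K, f - aeval l f ∈ idealOfVars σ K := fun f => by
    induction f using MvPolynomial.induction_on with
    | C a => simp
    | add f g hf hg =>
      rw [map_add, add_sub_add_comm]
      exact add_mem hf hg
    | mul_X f v hf =>
      have : f * X v - aeval l (f * X v) = (f - aeval l f) * X v + aeval l f * (X v - l v) := by
        simp only [map_mul, aeval_X]; ring
      rw [this]
      exact add_mem (Ideal.mul_mem_right _ _ hf)
        (Ideal.mul_mem_left _ _ (Ideal.pow_le_self two_ne_zero (hl v)))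
  have h1 : ∀ f ∈ idealOfVars σ K, f - aeval l f ∈ idealOfVars σ K ^ 2 := fun f hf => by
    induction hf using Submodule.span_induction with
    | mem x hx =>
      obtain ⟨v, rfl⟩ := hx
      simpa using hl v
    | zero => simp
    | add f g _ _ hf hg =>
      rw [map_add, add_sub_add_comm]
      exact add_mem hf hg
    | smul a f hf' hf =>
      have : a • f - aeval l (a • f) = (a - aeval l a) * f + aeval l a * (f - aeval l f) := by
        simp only [smul_eq_mul, map_mul]; ring
      rw [this, pow_two]
      exact add_mem (Ideal.mul_mem_mul (h0 a) hf') (Ideal.mul_mem_left _ _ (pow_two (idealOfVars σ K) ▸ hf))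
  induction k generalizing f with
  | zero => simpa using h0 f
  | succ k ih =>
    rw [pow_succ] at hf
    induction hf using Submodule.mul_induction_on' with
    | mem_mul_mem a ha b hb =>
      have : a * b - aeval l (a * b) = (a - aeval l a) * aeval l b + a * (b - aeval l b) := by
        simp only [map_mul]; ring
      rw [this]
      have hlb : aeval l b ∈ idealOfVars σ K := by
        have := sub_mem hb (h0 b)
        rwa [sub_sub_cancel] at this
      refine add_mem ?_ ?_
      · rw [pow_succ]
        exact Ideal.mul_mem_mul (ih ha) hlb
      · rw [show k + 1 + 1 = k + 2 by ring, pow_add]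
        exact Ideal.mul_mem_mul ha (h1 b hb)
    | add f _ g _ hf hg =>
      rw [map_add, add_sub_add_comm]
      exact add_mem hf hg

theorem exists_sub_aeval_mem_pow (hY : ∀ u, constantCoeff (Y u) = 0)
    (hdet : (jacobianMatrix Y).det ≠ 0) (k : ℕ) (f : MvPolynomial σ K) :
    ∃ g : MvPolynomial σ K, f - aeval Y g ∈ idealOfVars σ K ^ k := by
  obtain ⟨l, hlY, hl⟩ := exists_span_range_sub_mem hY hdet
  have hrange : ∀ f : MvPolynomial σ K, ∃ g : MvPolynomial σ K, aeval l f = aeval Y g := fun f => by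
    have hl' : ∀ v, l v ∈ (aeval Y : MvPolynomial σ K →ₐ[K] _).range := fun v => by
      refine (Submodule.span_le (p := Subalgebra.toSubmodule
        (aeval Y : MvPolynomial σ K →ₐ[K] MvPolynomial σ K).range)).2 ?_ (hlY v)
      rintro _ ⟨u, rfl⟩
      exact (AlgHom.mem_range (aeval Y : MvPolynomial σ K →ₐ[K] _)).2 ⟨X u, aeval_X _ _⟩
    have : aeval l f ∈ (aeval Y : MvPolynomial σ K →ₐ[K] _).range := by
      have h1 : Algebra.adjoin K (Set.range l) ≤ (aeval Y : MvPolynomial σ K →ₐ[K] _).range :=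
        Algebra.adjoin_le (by rintro _ ⟨v, rfl⟩; exact hl' v)
      rw [Algebra.adjoin_range_eq_range_aeval] at h1
      exact h1 ⟨f, rfl⟩
    obtain ⟨g, hg⟩ := this
    exact ⟨g, hg.symm⟩
  induction k with
  | zero => exact ⟨0, by simp⟩
  | succ k ih =>
    obtain ⟨g, hg⟩ := ih
    obtain ⟨g', hg'⟩ := hrange (f - aeval Y g)
    refine ⟨g + g', ?_⟩
    have := sub_aeval_mem hl k hg
    rwa [hg', sub_sub, ← map_add] at this

variable {p : ℕ} [Fact p.Prime] [CharP K p]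

omit [Fintype σ] [DecidableEq σ] in
theorem aeval_mem_varPowIdeal (hY : ∀ u, constantCoeff (Y u) = 0) (e : ℕ)
    {f : MvPolynomial σ K} (hf : f ∈ varPowIdeal σ K (p ^ e)) :
    aeval Y f ∈ varPowIdeal σ K (p ^ e) := by
  have : varPowIdeal σ K (p ^ e) ≤
      (varPowIdeal σ K (p ^ e)).comap (aeval Y : MvPolynomial σ K →ₐ[K] _) := by
    conv_lhs => rw [varPowIdeal]
    rw [Ideal.span_le]
    rintro _ ⟨v, rfl⟩
    simpa using pow_mem_varPowIdeal (hY v) e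
  exact this hf

/-- The substitution `x ↦ Y` induces an endomorphism of the finite-dimensional space
`K[x]/(x_v^(p^e))`. It is surjective by approximation modulo powers of `(x_v)`, hence injective. -/
theorem mem_varPowIdeal_of_aeval_mem (hY : ∀ u, constantCoeff (Y u) = 0)
    (hdet : (jacobianMatrix Y).det ≠ 0) (e : ℕ) {f : MvPolynomial σ K}
    (hf : aeval Y f ∈ varPowIdeal σ K (p ^ e)) : f ∈ varPowIdeal σ K (p ^ e) := by
  have hq : 0 < p ^ e := pow_pos (Fact.out : p.Prime).pos e
  set J := varPowIdeal σ K (p ^ e)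
  have hle : J ≤ J.comap (aeval Y : MvPolynomial σ K →ₐ[K] _) :=
    fun f hf => aeval_mem_varPowIdeal hY e hf
  set θ : (MvPolynomial σ K ⧸ J) →ₐ[K] (MvPolynomial σ K ⧸ J) := Ideal.quotientMapₐ J (aeval Y) hle
  have hθ : ∀ f, θ (Ideal.Quotient.mk J f) = Ideal.Quotient.mk J (aeval Y f) := fun f => rfl
  have hsurj : Function.Surjective θ := fun a => by
    obtain ⟨f, rfl⟩ := Ideal.Quotient.mk_surjective a
    obtain ⟨N, hN⟩ := exists_idealOfVars_pow_le_varPowIdeal (σ := σ) (K := K) (p ^ e)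
    obtain ⟨g, hg⟩ := exists_sub_aeval_mem_pow hY hdet N f
    exact ⟨Ideal.Quotient.mk J g, ((Ideal.Quotient.eq).2 (hN hg)).symm⟩
  have hfin : Module.Finite K (MvPolynomial σ K ⧸ J) := by
    refine Module.Finite.of_surjective
      ((Ideal.Quotient.mkₐ K J).toLinearMap ∘ₗ (restrictDegree σ K (p ^ e)).subtype) fun a => ?_
    obtain ⟨f, rfl⟩ := Ideal.Quotient.mk_surjective a
    refine ⟨⟨∑ γ ∈ Finset.Icc 0 (topExponent σ (p ^ e)), monomial γ (coeff γ f), ?_⟩,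
      ((Ideal.Quotient.eq).2 (sub_truncation_mem_varPowIdeal hq f)).symm⟩
    refine Submodule.sum_mem _ fun γ hγ => (monomial_mem_restrictSupport K).2 (Or.inl fun v => ?_)
    exact ((Finset.mem_Icc.1 hγ).2 v).trans (Nat.sub_le _ _)
  have hinj : Function.Injective θ :=
    (LinearMap.injective_iff_surjective (f := θ.toLinearMap)).2 hsurj
  refine Ideal.Quotient.eq_zero_iff_mem.1 (hinj ?_)
  rw [hθ, map_zero]
  exact Ideal.Quotient.eq_zero_iff_mem.2 hf

theorem mem_sup_of_prod_X_pow_mul_mem {q : ℕ} (hq : 0 < q) (s : Finset σ) {f : MvPolynomial σ K}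
    (hf : (∏ v ∈ s, X v) ^ (q - 1) * f ∈ varPowIdeal σ K q) :
    f ∈ varPowIdeal σ K q ⊔ Ideal.span (X '' (s : Set σ)) := by
  have hprod : (∏ v ∈ s, X v : MvPolynomial σ K) ^ (q - 1) =
      monomial (∑ v ∈ s, Finsupp.single v (q - 1)) 1 := by
    rw [← Finset.prod_pow, monomial_sum_one]
    exact Finset.prod_congr rfl fun v _ => X_pow_eq_monomial
  rw [mem_varPowIdeal_iff, hprod] at hf
  rw [f.as_sum]
  refine Ideal.sum_mem _ fun γ hγ => ?_
  by_cases h1 : ∀ v, γ v < q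
  · have h2 : ∃ v ∈ s, γ v ≠ 0 := by
      by_contra! h2
      refine mem_support_iff.1 hγ ?_
      have := hf (∑ v ∈ s, Finsupp.single v (q - 1) + γ) fun v => ?_
      · rwa [coeff_monomial_mul, one_mul] at this
      · rw [Finsupp.add_apply, Finsupp.finsetSum_apply]
        by_cases hv : v ∈ s
        · rw [Finset.sum_eq_single v (fun u _ huv => Finsupp.single_eq_of_ne huv.symm)
            (fun h => absurd hv h), h2 v hv, Finsupp.single_eq_same]
          omega
        · rw [Finset.sum_eq_zero fun u hu => Finsupp.single_eq_of_ne fun h => hv (by rwa [h]),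
            zero_add]
          exact h1 v
    refine Ideal.mem_sup_right (mem_ideal_span_X_image.2 fun m hm => ?_)
    rw [Finset.mem_singleton.1 (support_monomial_subset hm)]
    exact h2
  · refine Ideal.mem_sup_left (mem_varPowIdeal_iff.2 fun δ hδ => ?_)
    rw [coeff_monomial, if_neg]
    rintro rfl
    exact h1 hδ

/-- The Fedder-type colon computation is evident for monomials; the substitution `x ↦ Y`, bijective
modulo `(x_v^(p^e))`, carries it over to `Y`. -/
theorem mem_sup_of_prod_pow_mul_mem (hY : ∀ u, constantCoeff (Y u) = 0)
    (hdet : (jacobianMatrix Y).det ≠ 0) (e : ℕ) (s : Finset σ) {f : MvPolynomial σ K}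
    (hf : (∏ v ∈ s, Y v) ^ (p ^ e - 1) * f ∈ varPowIdeal σ K (p ^ e)) :
    f ∈ varPowIdeal σ K (p ^ e) ⊔ Ideal.span (Y '' (s : Set σ)) := by
  have hq : 0 < p ^ e := pow_pos (Fact.out : p.Prime).pos e
  obtain ⟨N, hN⟩ := exists_idealOfVars_pow_le_varPowIdeal (σ := σ) (K := K) (p ^ e)
  obtain ⟨g, hg⟩ := exists_sub_aeval_mem_pow hY hdet N f
  have hfg := hN hg
  have h1 : aeval Y ((∏ v ∈ s, X v) ^ (p ^ e - 1) * g) ∈ varPowIdeal σ K (p ^ e) := by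
    have := sub_mem hf (Ideal.mul_mem_left _ ((∏ v ∈ s, Y v) ^ (p ^ e - 1)) hfg)
    rw [← mul_sub, sub_sub_cancel] at this
    simpa using this
  have h2 := mem_sup_of_prod_X_pow_mul_mem hq s (mem_varPowIdeal_of_aeval_mem hY hdet e h1)
  have h3 : varPowIdeal σ K (p ^ e) ⊔ Ideal.span (X '' (s : Set σ)) ≤
      (varPowIdeal σ K (p ^ e) ⊔ Ideal.span (Y '' (s : Set σ))).comap
        (aeval Y : MvPolynomial σ K →ₐ[K] _) := by
    refine sup_le (fun f hf => Ideal.mem_sup_left (aeval_mem_varPowIdeal hY e hf))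
      (Ideal.span_le.2 ?_)
    rintro _ ⟨v, hv, rfl⟩
    refine Ideal.mem_sup_right (Ideal.subset_span ⟨v, hv, ?_⟩)
    simp
  have h4 := add_mem (Ideal.mem_sup_left hfg) (h3 h2)
  have h5 : f - aeval Y g + aeval Y g ∈ _ := h4
  rwa [sub_add_cancel] at h5

theorem prod_pow_mul_mem_iff (hY : ∀ u, constantCoeff (Y u) = 0)
    (hdet : (jacobianMatrix Y).det ≠ 0) (e : ℕ) (s : Finset σ) {f : MvPolynomial σ K} :
    (∏ v ∈ s, Y v) ^ (p ^ e - 1) * f ∈ varPowIdeal σ K (p ^ e) ↔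
      f ∈ varPowIdeal σ K (p ^ e) ⊔ Ideal.span (Y '' (s : Set σ)) := by
  refine ⟨mem_sup_of_prod_pow_mul_mem hY hdet e s, fun hf => ?_⟩
  have : varPowIdeal σ K (p ^ e) ⊔ Ideal.span (Y '' (s : Set σ)) ≤
      (varPowIdeal σ K (p ^ e)).colon {(∏ v ∈ s, Y v) ^ (p ^ e - 1)} := by
    refine sup_le (fun g hg => ?_) (Ideal.span_le.2 ?_)
    · exact Submodule.mem_colon_singleton.2 (Ideal.mul_mem_right _ _ hg)
    · rintro _ ⟨v, hv, rfl⟩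
      refine Submodule.mem_colon_singleton.2 ?_
      rw [← Finset.mul_prod_erase s _ hv, mul_pow, smul_eq_mul, ← mul_assoc, ← pow_succ',
        Nat.sub_add_cancel (Nat.one_le_pow _ _ (Fact.out : p.Prime).pos)]
      exact Ideal.mul_mem_right _ _ (pow_mem_varPowIdeal (hY v) e)
  have h := Submodule.mem_colon_singleton.1 (this hf)
  rwa [smul_eq_mul, mul_comm] at h

end Coordinates

end FThreshold

namespace FThreshold

/-! ### Transfer from the polynomial ring to the local ring -/

open MvPolynomial IsLocalRing

section Chart

variable {σ ι K A : Type*} [Fintype σ] [DecidableEq σ] [Field K]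
  [CommRing A] [IsLocalRing A] {p : ℕ} [Fact p.Prime] [CharP K p] [CharP A p]
  {θ : MvPolynomial σ K →+* A} {Y : σ → MvPolynomial σ K} {s : Finset σ}

theorem exists_notMem_sup_frobeniusPower {A : Type*} [CommRing A] [IsLocalRing A]
    [IsNoetherianRing A] (p : ℕ) [Fact p.Prime] {I : Ideal A} {z : A} (hz : z ∉ I) :
    ∃ e, z ∉ I ⊔ frobeniusPower (maximalIdeal A) (p ^ e) := by
  have h0 : (Ideal.Quotient.mk I z) ∉ (⊥ : Submodule A (A ⧸ I)) := fun h =>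
    hz (Ideal.Quotient.eq_zero_iff_mem.1 h)
  rw [← Ideal.iInf_pow_smul_eq_bot_of_isLocalRing (maximalIdeal A)
    (maximalIdeal.isMaximal A).ne_top, Submodule.mem_iInf] at h0
  push Not at h0
  obtain ⟨i, hi⟩ := h0
  refine ⟨i, fun hcon => hi ?_⟩
  obtain ⟨u, hu, w, hw, rfl⟩ := Submodule.mem_sup.1 hcon
  have hw' : w ∈ maximalIdeal A ^ i := Ideal.pow_le_pow_right
    (Nat.lt_pow_self (Fact.out : p.Prime).one_lt).le (frobeniusPower_le_pow _ _ hw)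
  rw [map_add, Ideal.Quotient.eq_zero_iff_mem.2 hu, zero_add]
  have : Ideal.Quotient.mk I w = w • (1 : A ⧸ I) := by
    rw [Algebra.smul_def, mul_one]; rfl
  rw [this]
  exact Submodule.smul_mem_smul hw' Submodule.mem_top

omit [IsLocalRing A] in
theorem frobeniusPower_antitone {J : Ideal A} (e e' : ℕ) :
    frobeniusPower J (p ^ (e + e')) ≤ frobeniusPower J (p ^ e') := by
  rw [← frobeniusPower_frobeniusPower]
  exact frobeniusPower_mono (frobeniusPower_le _ (pow_ne_zero _ (Fact.out : p.Prime).ne_zero)) _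

/-- The relation is lifted to `K[x]`, where a factor `y^(p^e - 1)` absorbs the equations `Y_v`.
Self-duality of `K[x]/(x_v^(p^N))` replaces `z` by the socle monomial, whose `p^e`-th power can be
cancelled; the Fedder-type colon then removes `y^(p^e - 1)`. -/
theorem hasFrobeniusColon_of_chart [IsNoetherianRing A] (hY : ∀ u, constantCoeff (Y u) = 0)
    (hdet : (jacobianMatrix Y).det ≠ 0)
    (hsurj : ∀ (e : ℕ) (a : A), ∃ g, a - θ g ∈ frobeniusPower (maximalIdeal A) (p ^ e))
    (hker : ∀ (e : ℕ) (g : MvPolynomial σ K), θ g ∈ frobeniusPower (maximalIdeal A) (p ^ e) ↔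
      g ∈ varPowIdeal σ K (p ^ e) ⊔ Ideal.span (Y '' (s : Set σ))) :
    HasFrobeniusColon A p := by
  intro I z hz e c h
  -- Enlarging `I` by a Frobenius power of `𝔪` that still avoids `z` makes the lifted ideal contain
  -- the `p^N`-th powers of the variables, as the duality requires.
  obtain ⟨N, hN⟩ := exists_notMem_sup_frobeniusPower p hz
  set 𝔪 := maximalIdeal A
  obtain ⟨z', hz'⟩ := hsurj N z
  obtain ⟨c', hc'⟩ := hsurj (N + e) c
  set I' := (I ⊔ frobeniusPower 𝔪 (p ^ N)).comap θ with hI'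
  have hz'I : z' ∉ I' := fun hcon => hN (by
    have := add_mem (Ideal.mem_sup_right hz') (Ideal.mem_comap.1 hcon)
    rwa [sub_add_cancel] at this)
  have hvar : varPowIdeal σ K (p ^ N) ≤ I' := fun g hg =>
    Ideal.mem_sup_right ((hker N g).2 (Ideal.mem_sup_left hg))
  have hYI : ∀ v ∈ s, Y v ∈ I' := fun v hv =>
    Ideal.mem_sup_right ((hker N _).2 (Ideal.mem_sup_right (Ideal.subset_span ⟨v, hv, rfl⟩)))
  obtain ⟨w, hwI, hwz⟩ := exists_mul_mem_varPowIdeal (pow_pos (Fact.out : p.Prime).pos N) hvar hz'I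
  have hpow : ∀ x ∈ frobeniusPower 𝔪 (p ^ N), x ^ p ^ e ∈ frobeniusPower 𝔪 (p ^ (N + e)) :=
    fun x hx => by
      rw [← frobeniusPower_frobeniusPower]
      exact pow_mem_frobeniusPower hx _
  have hlift : ∀ x ∈ frobeniusPower I (p ^ e), ∃ v ∈ frobeniusPower I' (p ^ e),
      x - θ v ∈ frobeniusPower 𝔪 (p ^ (N + e)) := by
    intro x hx
    induction hx using Submodule.span_induction with
    | mem x hx =>
      obtain ⟨u, hu, rfl⟩ := hx
      obtain ⟨u', hu'⟩ := hsurj N u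
      refine ⟨u' ^ p ^ e, pow_mem_frobeniusPower ?_ _, ?_⟩
      · have := sub_mem (Ideal.mem_sup_left hu) (Ideal.mem_sup_right (S := I) hu')
        rwa [sub_sub_cancel] at this
      · have := hpow _ hu'
        rwa [sub_pow_char_pow, ← map_pow] at this
    | zero => exact ⟨0, zero_mem _, by simp⟩
    | add x y _ _ hx hy =>
      obtain ⟨v, hv, hxv⟩ := hx
      obtain ⟨v', hv', hyv⟩ := hy
      refine ⟨v + v', add_mem hv hv', ?_⟩
      rw [map_add, add_sub_add_comm]
      exact add_mem hxv hyv
    | smul a x _ hx =>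
      obtain ⟨v, hv, hxv⟩ := hx
      obtain ⟨a', ha'⟩ := hsurj (N + e) a
      refine ⟨a' * v, Ideal.mul_mem_left _ _ hv, ?_⟩
      have : a • x - θ (a' * v) = (a - θ a') * x + θ a' * (x - θ v) := by
        rw [map_mul, smul_eq_mul]; ring
      rw [this]
      exact add_mem (Ideal.mul_mem_right _ _ ha') (Ideal.mul_mem_left _ _ hxv)
  obtain ⟨v, hv, hxv⟩ := hlift _ h
  have h1 : θ (c' * z' ^ p ^ e - v) ∈ frobeniusPower 𝔪 (p ^ (N + e)) := by
    have h2 := hpow _ hz'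
    rw [sub_pow_char_pow, ← map_pow] at h2
    have h3 := sub_mem hxv (add_mem (Ideal.mul_mem_right (z ^ p ^ e) _ hc')
      (Ideal.mul_mem_left _ (θ c') h2))
    convert h3 using 1
    rw [map_sub, map_mul]
    ring
  have hvar' : varPowIdeal σ K (p ^ (N + e)) ≤ frobeniusPower I' (p ^ e) := by
    rw [varPowIdeal_eq_frobeniusPower, ← frobeniusPower_frobeniusPower,
      ← varPowIdeal_eq_frobeniusPower]
    exact frobeniusPower_mono hvar _
  set y := ∏ v ∈ s, Y v with hy
  have h2 : y ^ (p ^ e - 1) * (c' * z' ^ p ^ e - v) ∈ frobeniusPower I' (p ^ e) := by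
    have hle : varPowIdeal σ K (p ^ (N + e)) ⊔ Ideal.span (Y '' (s : Set σ)) ≤
        (frobeniusPower I' (p ^ e)).colon {y ^ (p ^ e - 1)} := by
      refine sup_le (fun g hg => ?_) (Ideal.span_le.2 ?_)
      · exact Submodule.mem_colon_singleton.2 (Ideal.mul_mem_right _ _ (hvar' hg))
      · rintro _ ⟨v, hv, rfl⟩
        refine Submodule.mem_colon_singleton.2 ?_
        rw [hy, ← Finset.mul_prod_erase s _ hv, mul_pow, smul_eq_mul, ← mul_assoc, ← pow_succ',
          Nat.sub_add_cancel (Nat.one_le_pow _ _ (Fact.out : p.Prime).pos)]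
        exact Ideal.mul_mem_right _ _ (pow_mem_frobeniusPower (hYI v hv) _)
    have := Submodule.mem_colon_singleton.1 (hle ((hker _ _).1 h1))
    rwa [smul_eq_mul, mul_comm] at this
  have h3 : y ^ (p ^ e - 1) * c' * z' ^ p ^ e ∈ frobeniusPower I' (p ^ e) := by
    have := add_mem h2 (Ideal.mul_mem_left _ (y ^ (p ^ e - 1)) hv)
    rwa [← mul_add, sub_add_cancel, ← mul_assoc] at this
  have hwpow : ∀ g ∈ frobeniusPower I' (p ^ e), w ^ p ^ e * g ∈ varPowIdeal σ K (p ^ (N + e)) := by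
    intro g hg
    have hle : frobeniusPower I' (p ^ e) ≤
        (varPowIdeal σ K (p ^ (N + e))).colon {w ^ p ^ e} := by
      refine Ideal.span_le.2 ?_
      rintro _ ⟨u, hu, rfl⟩
      refine Submodule.mem_colon_singleton.2 ?_
      simp only [smul_eq_mul]
      rw [← mul_pow, mul_comm]
      exact pow_mem_varPowIdeal_of_mem (hwI u hu) e
    have := Submodule.mem_colon_singleton.1 (hle hg)
    rwa [smul_eq_mul, mul_comm] at this
  have h4 : y ^ (p ^ e - 1) * c' * monomial (topExponent σ (p ^ N)) 1 ^ p ^ e ∈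
      varPowIdeal σ K (p ^ N * p ^ e) := by
    have h5 := pow_mem_varPowIdeal_of_mem hwz e
    rw [sub_pow_char_pow] at h5
    have h6 := sub_mem (hwpow _ h3) (Ideal.mul_mem_left _ (y ^ (p ^ e - 1) * c') h5)
    rw [← pow_add]
    convert h6 using 1
    ring
  have h5 := pow_mul_mem_varPowIdeal (pow_pos (Fact.out : p.Prime).pos N) h4
  have h6 := (hker e c').2 (mem_sup_of_prod_pow_mul_mem hY hdet e s h5)
  have h7 := add_mem (frobeniusPower_antitone N e hc') h6
  rwa [sub_add_cancel] at h7

theorem span_pow_le_iff [Fintype ι] {B : Type*} [CommRing B] (g : ι → B) (r : ℕ) (I : Ideal B) :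
    Ideal.span (Set.range g) ^ r ≤ I ↔ ∀ i : ι → ℕ, ∑ j, i j = r → ∏ j, g j ^ i j ∈ I := by
  classical
  constructor
  · rintro h i rfl
    refine h ?_
    rw [← Finset.prod_pow_eq_pow_sum]
    exact Ideal.prod_mem_prod fun j _ =>
      Ideal.pow_mem_pow (Ideal.subset_span (Set.mem_range_self j)) _
  · intro h
    suffices hle : Ideal.span (Set.range g) ^ r ≤
        Ideal.span {x | ∃ i : ι → ℕ, ∑ j, i j = r ∧ ∏ j, g j ^ i j = x} by
      refine hle.trans (Ideal.span_le.2 ?_)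
      rintro _ ⟨i, hi, rfl⟩
      exact h i hi
    clear h
    induction r with
      | zero =>
        rw [pow_zero, Ideal.one_eq_top, top_le_iff, Ideal.eq_top_iff_one]
        exact Ideal.subset_span ⟨0, by simp, by simp⟩
      | succ r ih =>
        rw [pow_succ]
        refine (Ideal.mul_mono_left ih).trans ?_
        rw [Ideal.span_mul_span', Ideal.span_le]
        rintro _ ⟨_, ⟨i, hi, rfl⟩, _, ⟨j, rfl⟩, rfl⟩
        refine Ideal.subset_span ⟨i + Pi.single j 1, ?_, ?_⟩
        · simp [Finset.sum_add_distrib, hi]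
        · simp only [Pi.add_apply, pow_add, Finset.prod_mul_distrib]
          congr 1
          rw [Finset.prod_eq_single j]
          · simp
          · intro k _ hk
            simp [Pi.single_eq_of_ne hk]
          · simp

-- Powers of an ideal are generated by monomials in its generators. Those with some `i_j ≥ p^e` lie
-- in `𝔪^{[p^e]}`, as `f_j` has no constant term, so only exponents below `p^e` count.
omit [CharP A p] in
theorem noncontainmentValues_eq_mixedValues [Fintype ι] (hY : ∀ u, constantCoeff (Y u) = 0)
    (hdet : (jacobianMatrix Y).det ≠ 0)
    (hker : ∀ (e : ℕ) (g : MvPolynomial σ K), θ g ∈ frobeniusPower (maximalIdeal A) (p ^ e) ↔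
      g ∈ varPowIdeal σ K (p ^ e) ⊔ Ideal.span (Y '' (s : Set σ)))
    {f : ι → MvPolynomial σ K} (hf : ∀ j, constantCoeff (f j) = 0) :
    noncontainmentValues p (Ideal.span (Set.range fun j => θ (f j))) =
      mixedValues p (∏ v ∈ s, Y v) f := by
  classical
  have hmem : ∀ e (i : ι → ℕ), ∏ j, θ (f j) ^ i j ∈ frobeniusPower (maximalIdeal A) (p ^ e) ↔
      mixedPower p (∏ v ∈ s, Y v) f e i ∈ varPowIdeal σ K (p ^ e) := fun e i => by
    rw [mixedPower, prod_pow_mul_mem_iff hY hdet, ← hker, map_prod]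
    simp only [map_pow]
  ext x
  constructor
  · rintro ⟨e, r, h, rfl⟩
    rw [span_pow_le_iff] at h
    push Not at h
    obtain ⟨i, rfl, hi⟩ := h
    rw [hmem] at hi
    have hlt : ∀ j, i j < p ^ e := fun j => by
      by_contra! hle
      refine hi ?_
      rw [mixedPower, ← Finset.mul_prod_erase _ _ (Finset.mem_univ j),
        ← Nat.sub_add_cancel hle, pow_add]
      exact Ideal.mul_mem_left _ _ (Ideal.mul_mem_right _ _
        (Ideal.mul_mem_left _ _ (pow_mem_varPowIdeal (hf j) e)))
    rw [mem_varPowIdeal_iff] at hi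
    push Not at hi
    obtain ⟨γ, hγ, hne⟩ := hi
    exact ⟨e, i, γ, hlt, hγ, hne, rfl⟩
  · rintro ⟨e, i, γ, -, hγ, hne, rfl⟩
    refine ⟨e, _, fun hle => hne ?_, rfl⟩
    exact mem_varPowIdeal_iff.1 ((hmem e i).1 ((span_pow_le_iff _ _ _).1 hle i rfl)) γ hγ

end Chart

end FThreshold

namespace FThreshold

/-! ### Regular local rings are domains -/

open IsLocalRing

section RegularLocal

universe u

/-- As `x ∉ 𝔪²`, some coefficient of `x` in terms of the generators is a unit, and that generator
becomes redundant modulo `x`. -/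
theorem exists_finset_span_maximalIdeal_quotient {R : Type u} [CommRing R] [IsLocalRing R]
    {d : ℕ} {s : Finset R} (hs : s.card ≤ d + 1) (hspan : Ideal.span (s : Set R) = maximalIdeal R)
    {x : R} (hx : x ∈ maximalIdeal R) (hx2 : x ∉ maximalIdeal R ^ 2)
    [IsLocalRing (R ⧸ Ideal.span {x})] :
    ∃ t : Finset (R ⧸ Ideal.span {x}), t.card ≤ d ∧
      Ideal.span (t : Set (R ⧸ Ideal.span {x})) = maximalIdeal (R ⧸ Ideal.span {x}) := by
  classical
  set π := Ideal.Quotient.mk (Ideal.span {x})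
  have hπx : π x = 0 := Ideal.Quotient.eq_zero_iff_mem.2 (Ideal.mem_span_singleton_self x)
  have hmap : maximalIdeal (R ⧸ Ideal.span {x}) = (maximalIdeal R).map π := by
    refine le_antisymm (fun a ha => ?_) (Ideal.map_le_iff_le_comap.2 fun a ha => ?_)
    · obtain ⟨a, rfl⟩ := Ideal.Quotient.mk_surjective a
      refine Ideal.mem_map_of_mem _ ((mem_maximalIdeal _).2 fun hu => ?_)
      exact (mem_maximalIdeal _).1 ha (hu.map π)
    · refine (mem_maximalIdeal _).2 fun hu => ?_
      obtain ⟨b, hb⟩ := hu.exists_right_inv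
      obtain ⟨b, rfl⟩ := Ideal.Quotient.mk_surjective b
      rw [← map_mul, ← map_one π, Ideal.Quotient.eq] at hb
      have h1 : (1 : R) ∈ maximalIdeal R := by
        have h2 := sub_mem (Ideal.mul_mem_right b _ ha)
          ((Ideal.span_singleton_le_iff_mem _).2 hx hb)
        rwa [sub_sub_cancel] at h2
      exact (maximalIdeal.isMaximal R).ne_top ((Ideal.eq_top_iff_one _).2 h1)
  rw [← hspan] at hx
  obtain ⟨a, ha⟩ := Submodule.mem_span_finset'.1 hx
  have hunit : ∃ i : s, IsUnit (a i) := by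
    by_contra! hcon
    refine hx2 ?_
    rw [← ha, pow_two]
    refine Ideal.sum_mem _ fun i _ => Ideal.mul_mem_mul ((mem_maximalIdeal _).2 (hcon i)) ?_
    rw [← hspan]
    exact Ideal.subset_span i.2
  obtain ⟨i, hi⟩ := hunit
  refine ⟨(s.erase i).image π, ?_, ?_⟩
  · refine Finset.card_image_le.trans ?_
    rw [Finset.card_erase_of_mem i.2]
    omega
  · rw [hmap, ← hspan, Ideal.map_span, Finset.coe_image]
    refine le_antisymm (Ideal.span_mono (Set.image_mono (Finset.coe_subset.2
      (Finset.erase_subset _ _)))) (Ideal.span_le.2 ?_)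
    rintro _ ⟨j, hj, rfl⟩
    by_cases hji : j = i
    · subst hji
      have h1 : π (a i) * π i + ∑ k ∈ Finset.univ.erase i, π (a k) * π k = 0 := by
        rw [Finset.add_sum_erase Finset.univ (fun k : s => π (a k) * π k) (Finset.mem_univ i),
          ← hπx]
        conv_rhs => rw [← congrArg π ha]
        simp only [map_sum, smul_eq_mul, map_mul]
      have h2 : π (a i) * π i ∈ Ideal.span (π '' (s.erase (i : R) : Finset R)) := by
        rw [eq_neg_of_add_eq_zero_left h1]
        refine neg_mem (Ideal.sum_mem _ fun k hk => Ideal.mul_mem_left _ _ ?_)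
        refine Ideal.subset_span ⟨k, ?_, rfl⟩
        rw [Finset.mem_coe, Finset.mem_erase]
        exact ⟨fun h => (Finset.mem_erase.1 hk).1 (Subtype.ext h), k.2⟩
      exact (Ideal.unit_mul_mem_iff_mem _ (hi.map π)).1 h2
    · exact Ideal.subset_span ⟨j, Finset.mem_coe.2 (Finset.mem_erase.2 ⟨hji, hj⟩), rfl⟩

/-- A noetherian local ring of dimension at least the number of generators of its maximal ideal
is a domain. -/
theorem isDomain_of_card_le_ringKrullDim (d : ℕ) {R : Type u} [CommRing R] [IsLocalRing R]
    [IsNoetherianRing R] {s : Finset R} (hs : s.card ≤ d)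
    (hspan : Ideal.span (s : Set R) = maximalIdeal R) (hdim : (d : WithBot ℕ∞) ≤ ringKrullDim R) :
    IsDomain R := by
  induction d generalizing R with
  | zero =>
    rw [Nat.le_zero, Finset.card_eq_zero] at hs
    have : maximalIdeal R = ⊥ := by rw [← hspan, hs]; simp
    exact (isField_iff_maximalIdeal_eq.2 this).isDomain
  | succ d ih =>
    have hpos : ringKrullDim R ≠ 0 := fun h0 => by
      rw [h0] at hdim
      have : ((d + 1 : ℕ) : WithBot ℕ∞) ≤ ((0 : ℕ) : WithBot ℕ∞) := by exact_mod_cast hdim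
      have := WithBot.coe_le_coe.1 this
      simp at this
    have hnfield : ¬ Ring.KrullDimLE 0 R := fun h =>
      hpos ((ringKrullDimZero_iff_ringKrullDim_eq_zero).1 h)
    -- Prime avoidance, which tolerates the non-prime ideal `𝔪²`: containment of `𝔪` in `𝔪²` or in a
    -- minimal prime would force dimension `0`.
    obtain ⟨x, hx, hx2, hxP⟩ : ∃ x ∈ maximalIdeal R, x ∉ maximalIdeal R ^ 2 ∧
        ∀ P ∈ minimalPrimes R, x ∉ P := by
      by_contra! hcon
      have hsub : (maximalIdeal R : Set R) ⊆
          ⋃ I ∈ insert (maximalIdeal R ^ 2) (minimalPrimes R), (I : Set R) := fun x hx => by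
        by_cases h2 : x ∈ maximalIdeal R ^ 2
        · exact Set.mem_biUnion (Set.mem_insert _ _) h2
        · obtain ⟨P, hP, hxP⟩ := hcon x hx h2
          exact Set.mem_biUnion (Set.mem_insert_of_mem _ hP) hxP
      have hiff := Ideal.subset_union_prime_finite (I := maximalIdeal R)
        ((minimalPrimes.finite_of_isNoetherianRing R).insert (maximalIdeal R ^ 2))
        (f := fun I : Ideal R => I) (maximalIdeal R ^ 2) (maximalIdeal R ^ 2)
        fun I hI hne _ => (Set.mem_of_mem_insert_of_ne hI hne).1.1
      · obtain ⟨I, hI, hle⟩ := hiff.1 hsub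
        rcases Set.mem_insert_iff.1 hI with rfl | hI
        · have hbot : maximalIdeal R = ⊥ := by
            refine Submodule.eq_bot_of_le_smul_of_le_jacobson_bot (maximalIdeal R) _
              (IsNoetherian.noetherian _) ?_ (maximalIdeal_le_jacobson _)
            rw [smul_eq_mul, ← pow_two]
            exact hle
          exact hpos (ringKrullDim_eq_zero_of_isField (isField_iff_maximalIdeal_eq.2 hbot))
        · refine hnfield (Ring.krullDimLE_zero_iff.2 fun J hJ => ?_)
          have h1 : J ≤ maximalIdeal R := le_maximalIdeal hJ.ne_top
          have h2 : maximalIdeal R ≤ J :=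
            hle.trans (hI.2 ⟨hJ, bot_le⟩ (h1.trans hle))
          exact le_antisymm h1 h2 ▸ maximalIdeal.isMaximal R
    have hxtop : Ideal.span {x} ≠ ⊤ := fun h =>
      (maximalIdeal.isMaximal R).ne_top (top_le_iff.1 (h ▸ (Ideal.span_singleton_le_iff_mem _).2 hx))
    have : Nontrivial (R ⧸ Ideal.span {x}) := Ideal.Quotient.nontrivial_iff.2 hxtop
    have : IsLocalRing (R ⧸ Ideal.span {x}) :=
      IsLocalRing.of_surjective' (Ideal.Quotient.mk _) Ideal.Quotient.mk_surjective
    obtain ⟨t, ht, htspan⟩ := exists_finset_span_maximalIdeal_quotient hs hspan hx hx2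
    have hdim' : (d : WithBot ℕ∞) ≤ ringKrullDim (R ⧸ Ideal.span {x}) := by
      have h1 := ringKrullDim_le_ringKrullDim_quotient_add_card {x} (by
        rw [IsLocalRing.ringJacobson_eq_maximalIdeal]
        simpa using hx)
      rw [Finset.coe_singleton, Finset.card_singleton] at h1
      have h2 := hdim.trans h1
      push_cast at h2
      exact ENat.WithBot.add_le_add_one_right_iff.1 h2
    have hprime : (Ideal.span {x}).IsPrime :=
      (Ideal.Quotient.isDomain_iff_prime _).1 (ih ht htspan hdim')
    obtain ⟨P, hP, hPx⟩ := Ideal.exists_minimalPrimes_le (I := ⊥) (J := Ideal.span {x}) bot_le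
    have hPprime : P.IsPrime := hP.1.1
    -- Since `P ⊆ (x)` and `x ∉ P`, one has `P = x P`, and Nakayama's lemma applies.
    have hPbot : P = ⊥ := by
      refine Submodule.eq_bot_of_le_smul_of_le_jacobson_bot (maximalIdeal R) _
        (IsNoetherian.noetherian _) (fun z hz => ?_) (maximalIdeal_le_jacobson _)
      obtain ⟨y, rfl⟩ := Ideal.mem_span_singleton'.1 (hPx hz)
      have hy : y ∈ P := (hPprime.mem_or_mem hz).resolve_right (hxP P hP)
      rw [mul_comm]
      exact Ideal.mul_mem_mul hx hy
    rw [hPbot] at hPprime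
    exact IsDomain.of_bot_isPrime R

end RegularLocal

end FThreshold

namespace FThreshold

/-! ### Regular systems of parameters -/

open IsLocalRing MvPolynomial

section Parameters

variable {σ B : Type*} [Fintype σ] [CommRing B] [IsLocalRing B] [IsNoetherianRing B] {Y : σ → B}

theorem map_maximalIdeal_of_surjective {R S : Type*} [CommRing R] [CommRing S] [IsLocalRing R]
    [IsLocalRing S] (f : R →+* S) (hf : Function.Surjective f) :
    (maximalIdeal R).map f = maximalIdeal S := by
  have : ((maximalIdeal S).comap f).IsMaximal := Ideal.comap_isMaximal_of_surjective f hf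
  rw [← eq_maximalIdeal this, Ideal.map_comap_of_surjective f hf]

omit [Fintype σ] [IsNoetherianRing B] in
theorem span_image_ne_top (hY : Ideal.span (Set.range Y) = maximalIdeal B) (s : Finset σ) :
    Ideal.span (Y '' (s : Set σ)) ≠ ⊤ := fun h =>
  (maximalIdeal.isMaximal B).ne_top (top_le_iff.1 (h ▸ (hY ▸ Ideal.span_mono
    (Set.image_subset_range _ _))))

omit [IsNoetherianRing B] in
theorem exists_span_eq_maximalIdeal_quotient (hY : Ideal.span (Set.range Y) = maximalIdeal B)
    (s : Finset σ) [IsLocalRing (B ⧸ Ideal.span (Y '' (s : Set σ)))] :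
    ∃ t : Finset (B ⧸ Ideal.span (Y '' (s : Set σ))), t.card ≤ Fintype.card σ - s.card ∧
      Ideal.span (t : Set (B ⧸ Ideal.span (Y '' (s : Set σ)))) = maximalIdeal _ := by
  classical
  refine ⟨sᶜ.image fun v => Ideal.Quotient.mk _ (Y v), ?_, ?_⟩
  · exact Finset.card_image_le.trans (Finset.card_compl s).le
  · rw [← map_maximalIdeal_of_surjective (Ideal.Quotient.mk _) Ideal.Quotient.mk_surjective, ← hY,
      Ideal.map_span, Finset.coe_image]
    refine le_antisymm (Ideal.span_mono ?_) (Ideal.span_le.2 ?_)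
    · rintro _ ⟨v, -, rfl⟩
      exact ⟨Y v, ⟨v, rfl⟩, rfl⟩
    · rintro _ ⟨_, ⟨v, rfl⟩, rfl⟩
      by_cases hv : v ∈ s
      · rw [Ideal.Quotient.eq_zero_iff_mem.2
          (Ideal.subset_span (Set.mem_image_of_mem Y (Finset.mem_coe.2 hv)))]
        exact zero_mem _
      · exact Ideal.subset_span ⟨v, by simpa using hv, rfl⟩

theorem le_ringKrullDim_quotient (hY : Ideal.span (Set.range Y) = maximalIdeal B)
    (hdim : (Fintype.card σ : WithBot ℕ∞) ≤ ringKrullDim B) (s : Finset σ) :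
    ((Fintype.card σ - s.card : ℕ) : WithBot ℕ∞) ≤
      ringKrullDim (B ⧸ Ideal.span (Y '' (s : Set σ))) := by
  classical
  have h1 := ringKrullDim_le_ringKrullDim_quotient_add_card (s.image Y) (by
    rw [IsLocalRing.ringJacobson_eq_maximalIdeal, ← hY]
    intro x hx
    obtain ⟨v, -, rfl⟩ := Finset.mem_image.1 hx
    exact Ideal.subset_span ⟨v, rfl⟩)
  rw [Finset.coe_image] at h1
  refine (ENat.WithBot.add_le_add_natCast_right_iff (c := s.card)).1 ?_
  have h2 : ((Fintype.card σ - s.card : ℕ) : WithBot ℕ∞) + s.card = Fintype.card σ := by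
    rw [← Nat.cast_add, Nat.sub_add_cancel (Finset.card_le_univ s)]
  rw [h2]
  refine (hdim.trans h1).trans (add_le_add_right ?_ _)
  exact_mod_cast Finset.card_image_le

theorem isDomain_quotient (hY : Ideal.span (Set.range Y) = maximalIdeal B)
    (hdim : (Fintype.card σ : WithBot ℕ∞) ≤ ringKrullDim B) (s : Finset σ) :
    IsDomain (B ⧸ Ideal.span (Y '' (s : Set σ))) := by
  have : Nontrivial (B ⧸ Ideal.span (Y '' (s : Set σ))) :=
    Ideal.Quotient.nontrivial_iff.2 (span_image_ne_top hY s)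
  have : IsLocalRing (B ⧸ Ideal.span (Y '' (s : Set σ))) :=
    IsLocalRing.of_surjective' (Ideal.Quotient.mk _) Ideal.Quotient.mk_surjective
  obtain ⟨t, ht, htspan⟩ := exists_span_eq_maximalIdeal_quotient hY s
  exact isDomain_of_card_le_ringKrullDim _ ht htspan (le_ringKrullDim_quotient hY hdim s)

theorem ringKrullDim_quotient_le (hY : Ideal.span (Set.range Y) = maximalIdeal B) (s : Finset σ) :
    ringKrullDim (B ⧸ Ideal.span (Y '' (s : Set σ))) ≤ (Fintype.card σ - s.card : ℕ) := by
  have : Nontrivial (B ⧸ Ideal.span (Y '' (s : Set σ))) :=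
    Ideal.Quotient.nontrivial_iff.2 (span_image_ne_top hY s)
  have : IsLocalRing (B ⧸ Ideal.span (Y '' (s : Set σ))) :=
    IsLocalRing.of_surjective' (Ideal.Quotient.mk _) Ideal.Quotient.mk_surjective
  obtain ⟨t, ht, htspan⟩ := exists_span_eq_maximalIdeal_quotient hY s
  refine (ringKrullDim_le_spanFinrank_maximalIdeal _).trans ?_
  have h1 := Submodule.spanFinrank_span_le_ncard_of_finite (R := B ⧸ Ideal.span (Y '' (s : Set σ)))
    t.finite_toSet
  rw [Set.ncard_coe_finset] at h1
  rw [← htspan]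
  exact_mod_cast h1.trans ht

/-- Parameters added one at a time give a chain of primes, strict because the dimension of the
quotient drops each time. -/
theorem card_le_height_span (hY : Ideal.span (Set.range Y) = maximalIdeal B)
    (hdim : (Fintype.card σ : WithBot ℕ∞) ≤ ringKrullDim B) (s : Finset σ) :
    (s.card : ℕ∞) ≤ (Ideal.span (Y '' (s : Set σ))).height := by
  classical
  induction s using Finset.induction_on with
  | empty => simp
  | insert a s ha ih =>
    have hp1 : (Ideal.span (Y '' (s : Set σ))).IsPrime :=
      (Ideal.Quotient.isDomain_iff_prime _).1 (isDomain_quotient hY hdim s)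
    have hp2 : (Ideal.span (Y '' (insert a s : Finset σ))).IsPrime :=
      (Ideal.Quotient.isDomain_iff_prime _).1 (isDomain_quotient hY hdim _)
    have hlt : Ideal.span (Y '' (s : Set σ)) < Ideal.span (Y '' (insert a s : Finset σ)) := by
      refine lt_of_le_of_ne (Ideal.span_mono (Set.image_mono ?_)) fun heq => ?_
      · exact Finset.coe_subset.2 (Finset.subset_insert _ _)
      · have h1 := le_ringKrullDim_quotient hY hdim s
        rw [heq] at h1
        have h2 := h1.trans (ringKrullDim_quotient_le hY _)
        have h3 : Fintype.card σ - s.card ≤ Fintype.card σ - (insert a s).card := by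
          exact_mod_cast h2
        have h4 := Finset.card_le_univ (insert a s)
        rw [Finset.card_insert_of_notMem ha] at h3 h4
        omega
    rw [Finset.card_insert_of_notMem ha]
    rw [Nat.cast_add, Nat.cast_one]
    exact (add_le_add_left ih 1).trans (Ideal.height_add_one_le_of_lt_of_isPrime hlt)

/-- `B/(Y_v : v ∈ s)` is a domain of dimension at most `|σ| - |s|`, so a proper quotient of it would
be too small to be `A`. -/
theorem ker_eq_span {A : Type*} [CommRing A] (hY : Ideal.span (Set.range Y) = maximalIdeal B)
    (hdim : (Fintype.card σ : WithBot ℕ∞) ≤ ringKrullDim B) {s : Finset σ} {g : B →+* A}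
    (hg : Function.Surjective g) (hgY : ∀ v ∈ s, g (Y v) = 0)
    (hA : ((Fintype.card σ - s.card : ℕ) : WithBot ℕ∞) ≤ ringKrullDim A) :
    RingHom.ker g = Ideal.span (Y '' (s : Set σ)) := by
  have hle : Ideal.span (Y '' (s : Set σ)) ≤ RingHom.ker g := by
    rw [Ideal.span_le]
    rintro _ ⟨v, hv, rfl⟩
    exact hgY v hv
  refine le_antisymm (fun r hr => ?_) hle
  by_contra hrs
  have := isDomain_quotient hY hdim s
  have h1 := ringKrullDim_succ_le_of_surjective (Ideal.Quotient.lift _ g hle)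
    (Ideal.Quotient.lift_surjective_of_surjective _ _ hg)
    (r := Ideal.Quotient.mk _ r) (mem_nonZeroDivisors_of_ne_zero fun h =>
      hrs (Ideal.Quotient.eq_zero_iff_mem.1 h)) hr
  have h2 := (add_le_add_left hA 1).trans (h1.trans (ringKrullDim_quotient_le hY s))
  have h3 : Fintype.card σ - s.card + 1 ≤ Fintype.card σ - s.card := by exact_mod_cast h2
  omega

end Parameters

section PolynomialLocalization

variable {σ K : Type*} [Fintype σ] [DecidableEq σ] [Field K]

instance idealOfVars_isMaximal : (idealOfVars σ K).IsMaximal := by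
  have : idealOfVars σ K = RingHom.ker (constantCoeff (R := K) (σ := σ)) := by
    ext f
    rw [mem_idealOfVars_iff, RingHom.mem_ker]
  rw [this]
  exact RingHom.ker_isMaximal_of_surjective _ fun a => ⟨C a, by simp⟩

omit [Fintype σ] in
theorem isPrime_span_X (s : Finset σ) :
    (Ideal.span (X '' (s : Set σ)) : Ideal (MvPolynomial σ K)).IsPrime := by
  set g : MvPolynomial σ K →ₐ[K] MvPolynomial σ K := aeval fun v => if v ∈ s then 0 else X v
  have hsub : ∀ f, f - g f ∈ Ideal.span (X '' (s : Set σ) : Set (MvPolynomial σ K)) := fun f => by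
    induction f using MvPolynomial.induction_on with
    | C a => simp [g]
    | add f h hf hh =>
      rw [map_add, add_sub_add_comm]
      exact add_mem hf hh
    | mul_X f v hf =>
      have : f * X v - g (f * X v) = (f - g f) * X v + g f * (X v - g (X v)) := by
        rw [map_mul]; ring
      rw [this]
      refine add_mem (Ideal.mul_mem_right _ _ hf) (Ideal.mul_mem_left _ _ ?_)
      by_cases hv : v ∈ s
      · simpa [g, hv] using Ideal.subset_span
          (Set.mem_image_of_mem (X : σ → MvPolynomial σ K) (Finset.mem_coe.2 hv))
      · simp [g, hv]
  have : (Ideal.span (X '' (s : Set σ)) : Ideal (MvPolynomial σ K)) = RingHom.ker g := by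
    refine le_antisymm (Ideal.span_le.2 ?_) fun f hf => ?_
    · rintro _ ⟨v, hv, rfl⟩
      simp [g, Finset.mem_coe.1 hv]
    · have := hsub f
      rwa [RingHom.mem_ker.1 hf, sub_zero] at this
  rw [this]
  exact RingHom.ker_isPrime _

omit [Fintype σ] in
theorem card_le_height_span_X (s : Finset σ) :
    (s.card : ℕ∞) ≤ (Ideal.span (X '' (s : Set σ)) : Ideal (MvPolynomial σ K)).height := by
  induction s using Finset.induction_on with
  | empty => simp
  | insert a s ha ih =>
    have := isPrime_span_X (K := K) s
    have := isPrime_span_X (K := K) (insert a s)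
    have hlt : (Ideal.span (X '' (s : Set σ)) : Ideal (MvPolynomial σ K)) <
        Ideal.span (X '' (insert a s : Finset σ)) := by
      refine lt_of_le_of_ne (Ideal.span_mono (Set.image_mono ?_)) fun heq => ?_
      · exact Finset.coe_subset.2 (Finset.subset_insert _ _)
      · have h1 : (X a : MvPolynomial σ K) ∈ Ideal.span (X '' (s : Set σ)) := by
          rw [heq]
          exact Ideal.subset_span ⟨a, by simp, rfl⟩
        obtain ⟨i, hi, hne⟩ := mem_ideal_span_X_image.1 h1 (Finsupp.single a 1) (by simp)
        have : i = a := by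
          by_contra hia
          exact hne (Finsupp.single_eq_of_ne hia)
        exact ha (this ▸ hi)
    rw [Finset.card_insert_of_notMem ha]
    rw [Nat.cast_add, Nat.cast_one]
    exact (add_le_add_left ih 1).trans (Ideal.height_add_one_le_of_lt_of_isPrime hlt)

variable (σ K) in
theorem card_le_ringKrullDim_localization :
    (Fintype.card σ : WithBot ℕ∞) ≤ ringKrullDim (Localization.AtPrime (idealOfVars σ K)) := by
  rw [IsLocalization.AtPrime.ringKrullDim_eq_height (idealOfVars σ K)]
  have := card_le_height_span_X (K := K) (Finset.univ : Finset σ)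
  rw [Finset.coe_univ, Set.image_univ] at this
  exact_mod_cast this

/-- By Nakayama's lemma it suffices that the `Y_u` generate modulo the square of the maximal ideal,
which the Jacobian determinant provides. -/
theorem span_range_eq_maximalIdeal_localization {Y : σ → MvPolynomial σ K}
    (hY : ∀ u, constantCoeff (Y u) = 0) (hdet : (jacobianMatrix Y).det ≠ 0) :
    Ideal.span (Set.range fun v => algebraMap _ (Localization.AtPrime (idealOfVars σ K)) (Y v)) =
      maximalIdeal (Localization.AtPrime (idealOfVars σ K)) := by
  set L := Localization.AtPrime (idealOfVars σ K)
  have hmax : (idealOfVars σ K).map (algebraMap _ L) = maximalIdeal L :=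
    IsLocalization.AtPrime.map_eq_maximalIdeal _ _
  have hspan : Ideal.span (Set.range fun v => algebraMap _ L (Y v)) =
      (Ideal.span (Set.range Y)).map (algebraMap _ L) := by
    rw [Ideal.map_span, ← Set.range_comp]
    rfl
  rw [hspan]
  refine le_antisymm ?_ ?_
  · rw [← hmax]
    refine Ideal.map_mono (Ideal.span_le.2 ?_)
    rintro _ ⟨u, rfl⟩
    exact mem_idealOfVars_iff.2 (hY u)
  · refine Submodule.le_of_le_smul_of_le_jacobson_bot (I := maximalIdeal L)
      (IsNoetherian.noetherian _) (maximalIdeal_le_jacobson _) ?_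
    rw [smul_eq_mul, ← hmax, ← Ideal.map_mul, ← Ideal.map_sup]
    refine Ideal.map_mono (Ideal.span_le.2 ?_)
    rintro _ ⟨v, rfl⟩
    obtain ⟨l, hlY, hl⟩ := exists_span_range_sub_mem hY hdet
    have h1 : l v ∈ Ideal.span (Set.range Y) := by
      refine (Submodule.span_le (p := (Ideal.span (Set.range Y)).restrictScalars K)).2 ?_ (hlY v)
      exact Ideal.subset_span
    have h2 := add_mem (Ideal.mem_sup_left h1) (Ideal.mem_sup_right (S := Ideal.span (Set.range Y))
      (pow_two (idealOfVars σ K) ▸ hl v))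
    rwa [add_sub_cancel] at h2

end PolynomialLocalization

end FThreshold

namespace FThreshold

/-! ### Local rings presented at the origin -/

open IsLocalRing MvPolynomial

section Presentation

/-- The ring homomorphism `θ` presents the local ring `A` as a quotient of the localization of
`K[x]` at the origin. -/
structure IsLocalPresentation {σ K A : Type*} [Field K] [CommRing A]
    (θ : MvPolynomial σ K →+* A) : Prop where
  isUnit_iff : ∀ u, IsUnit (θ u) ↔ constantCoeff u ≠ 0
  exists_mul_eq : ∀ a, ∃ u g, constantCoeff u ≠ 0 ∧ θ u * a = θ g

variable {σ K A : Type*} [Fintype σ] [DecidableEq σ] [Field K]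
  [CommRing A] {θ : MvPolynomial σ K →+* A} {Y : σ → MvPolynomial σ K} {s : Finset σ}

namespace IsLocalPresentation

omit [Fintype σ] [DecidableEq σ] in
theorem map_idealOfVars [IsLocalRing A] (hθ : IsLocalPresentation θ) :
    (idealOfVars σ K).map θ = maximalIdeal A := by
  refine le_antisymm (Ideal.map_le_iff_le_comap.2 fun u hu => ?_) fun a ha => ?_
  · refine (mem_maximalIdeal _).2 fun h => ?_
    exact (hθ.isUnit_iff u).1 h (mem_idealOfVars_iff.1 hu)
  · obtain ⟨u, g, hu, hg⟩ := hθ.exists_mul_eq a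
    refine (Ideal.unit_mul_mem_iff_mem _ ((hθ.isUnit_iff u).2 hu)).1 ?_
    rw [hg]
    refine Ideal.mem_map_of_mem _ (mem_idealOfVars_iff.2 ?_)
    by_contra hne
    have h1 := (hθ.isUnit_iff g).2 hne
    rw [← hg] at h1
    exact (mem_maximalIdeal _).1 ha (isUnit_of_mul_isUnit_right h1)

/-- The extension of a local presentation to the localization at the origin. -/
noncomputable def toLocalization (hθ : IsLocalPresentation θ) :
    Localization.AtPrime (idealOfVars σ K) →+* A :=
  IsLocalization.lift (M := (idealOfVars σ K).primeCompl) (g := θ) fun u =>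
    (hθ.isUnit_iff u).2 fun h => u.2 (mem_idealOfVars_iff.2 h)

omit [Fintype σ] [DecidableEq σ] in
theorem toLocalization_algebraMap (hθ : IsLocalPresentation θ) (f : MvPolynomial σ K) :
    hθ.toLocalization (algebraMap _ _ f) = θ f :=
  IsLocalization.lift_eq _ _

omit [Fintype σ] [DecidableEq σ] in
theorem toLocalization_surjective (hθ : IsLocalPresentation θ) :
    Function.Surjective hθ.toLocalization := fun a => by
  obtain ⟨u, g, hu, hg⟩ := hθ.exists_mul_eq a
  refine ⟨IsLocalization.mk' _ g (⟨u, fun h => hu (mem_idealOfVars_iff.1 h)⟩ :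
    (idealOfVars σ K).primeCompl), ?_⟩
  rw [toLocalization, IsLocalization.lift_mk'_spec]
  exact hg.symm

omit [DecidableEq σ] in
theorem isNoetherianRing (hθ : IsLocalPresentation θ) : IsNoetherianRing A :=
  isNoetherianRing_of_surjective _ _ hθ.toLocalization hθ.toLocalization_surjective

theorem ker_toLocalization (hθ : IsLocalPresentation θ) (hY : ∀ u, constantCoeff (Y u) = 0)
    (hdet : (jacobianMatrix Y).det ≠ 0) (hs : ∀ v ∈ s, θ (Y v) = 0)
    (hA : ((Fintype.card σ - s.card : ℕ) : WithBot ℕ∞) ≤ ringKrullDim A) :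
    RingHom.ker hθ.toLocalization = (Ideal.span (Y '' (s : Set σ))).map (algebraMap _ _) := by
  rw [ker_eq_span (span_range_eq_maximalIdeal_localization hY hdet)
    (card_le_ringKrullDim_localization σ K) hθ.toLocalization_surjective
    (fun v hv => by rw [toLocalization_algebraMap, hs v hv]) hA, Ideal.map_span, Set.image_image]

theorem card_le_height_ker (hθ : IsLocalPresentation θ) (hY : ∀ u, constantCoeff (Y u) = 0)
    (hdet : (jacobianMatrix Y).det ≠ 0) (hs : ∀ v ∈ s, θ (Y v) = 0)
    (hA : ((Fintype.card σ - s.card : ℕ) : WithBot ℕ∞) ≤ ringKrullDim A) :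
    (s.card : ℕ∞) ≤ (RingHom.ker θ).height := by
  have h1 := card_le_height_span (span_range_eq_maximalIdeal_localization hY hdet)
    (card_le_ringKrullDim_localization σ K) s
  rw [← ker_eq_span (span_range_eq_maximalIdeal_localization hY hdet)
    (card_le_ringKrullDim_localization σ K) hθ.toLocalization_surjective
    (fun v hv => by rw [toLocalization_algebraMap, hs v hv]) hA,
    ← IsLocalization.height_under (idealOfVars σ K).primeCompl] at h1
  have h2 : (RingHom.ker hθ.toLocalization).under (MvPolynomial σ K) = RingHom.ker θ := by
    ext f
    rw [Ideal.under, Ideal.mem_comap, RingHom.mem_ker, toLocalization_algebraMap, RingHom.mem_ker]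
  rwa [h2] at h1

theorem exists_mul_mem_span (hθ : IsLocalPresentation θ) (hY : ∀ u, constantCoeff (Y u) = 0)
    (hdet : (jacobianMatrix Y).det ≠ 0) (hs : ∀ v ∈ s, θ (Y v) = 0)
    (hA : ((Fintype.card σ - s.card : ℕ) : WithBot ℕ∞) ≤ ringKrullDim A)
    {g : MvPolynomial σ K} (hg : θ g = 0) :
    ∃ u, constantCoeff u ≠ 0 ∧ u * g ∈ Ideal.span (Y '' (s : Set σ)) := by
  have h1 : algebraMap _ (Localization.AtPrime (idealOfVars σ K)) g ∈
      (Ideal.span (Y '' (s : Set σ))).map (algebraMap _ _) := by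
    rw [← hθ.ker_toLocalization hY hdet hs hA, RingHom.mem_ker, toLocalization_algebraMap, hg]
  obtain ⟨u, hu, hmem⟩ := (IsLocalization.algebraMap_mem_map_algebraMap_iff
    (idealOfVars σ K).primeCompl _ _ _).1 h1
  exact ⟨u, fun h => hu (mem_idealOfVars_iff.2 h), hmem⟩

omit [Fintype σ] [DecidableEq σ] in
theorem exists_mul_eq_of_mem_map (hθ : IsLocalPresentation θ) {J : Ideal (MvPolynomial σ K)} {a : A}
    (ha : a ∈ J.map θ) : ∃ u, constantCoeff u ≠ 0 ∧ ∃ j ∈ J, θ u * a = θ j := by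
  induction ha using Submodule.span_induction with
  | mem x hx =>
    obtain ⟨j, hj, rfl⟩ := hx
    exact ⟨1, by simp, j, hj, by simp⟩
  | zero => exact ⟨1, by simp, 0, zero_mem _, by simp⟩
  | add x y _ _ hx hy =>
    obtain ⟨u, hu, j, hj, hxj⟩ := hx
    obtain ⟨v, hv, k, hk, hyk⟩ := hy
    refine ⟨u * v, by simp [hu, hv], v * j + u * k,
      add_mem (Ideal.mul_mem_left _ _ hj) (Ideal.mul_mem_left _ _ hk), ?_⟩
    simp only [map_mul, map_add, ← hxj, ← hyk]
    ring
  | smul b x _ hx =>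
    obtain ⟨u, hu, j, hj, hxj⟩ := hx
    obtain ⟨v, g, hv, hg⟩ := hθ.exists_mul_eq b
    refine ⟨u * v, by simp [hu, hv], g * j, Ideal.mul_mem_left _ _ hj, ?_⟩
    simp only [map_mul, smul_eq_mul, ← hxj, ← hg]
    ring

omit [DecidableEq σ] in
theorem _root_.FThreshold.exists_mul_sub_one_mem_varPowIdeal (q : ℕ) {u : MvPolynomial σ K}
    (hu : constantCoeff u ≠ 0) : ∃ u', u' * u - 1 ∈ varPowIdeal σ K q := by
  obtain ⟨N, hN⟩ := exists_idealOfVars_pow_le_varPowIdeal (σ := σ) (K := K) q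
  set J := varPowIdeal σ K q
  have h1 : IsNilpotent (Ideal.Quotient.mk J (u - C (constantCoeff u))) := by
    refine ⟨N, ?_⟩
    rw [← map_pow, Ideal.Quotient.eq_zero_iff_mem]
    exact hN (Ideal.pow_mem_pow (mem_idealOfVars_iff.2 (by simp)) _)
  have h2 : IsUnit (Ideal.Quotient.mk J (C (constantCoeff u))) :=
    ((isUnit_iff_ne_zero.2 hu).map C).map _
  have h3 := h1.isUnit_add_left_of_commute h2 (Commute.all _ _)
  rw [← map_add, add_sub_cancel] at h3
  obtain ⟨b, hb⟩ := h3.exists_left_inv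
  obtain ⟨u', rfl⟩ := Ideal.Quotient.mk_surjective b
  refine ⟨u', ?_⟩
  rwa [← map_mul, ← map_one (Ideal.Quotient.mk J), Ideal.Quotient.eq] at hb

variable [IsLocalRing A] {p : ℕ} [Fact p.Prime] [CharP K p] [CharP A p]

omit [Fintype σ] [DecidableEq σ] [CharP K p] in
theorem map_varPowIdeal (hθ : IsLocalPresentation θ) (e : ℕ) :
    (varPowIdeal σ K (p ^ e)).map θ = frobeniusPower (maximalIdeal A) (p ^ e) := by
  rw [← hθ.map_idealOfVars, idealOfVars, Ideal.map_span, frobeniusPower_span, varPowIdeal,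
    Ideal.map_span, Set.image_image, ← Set.range_comp, ← Set.range_comp]
  simp [Function.comp_def]

omit [DecidableEq σ] [CharP K p] in
theorem exists_sub_mem_frobeniusPower (hθ : IsLocalPresentation θ) (e : ℕ) (a : A) :
    ∃ g, a - θ g ∈ frobeniusPower (maximalIdeal A) (p ^ e) := by
  obtain ⟨u, g, hu, hg⟩ := hθ.exists_mul_eq a
  obtain ⟨u', hu'⟩ := exists_mul_sub_one_mem_varPowIdeal (p ^ e) hu
  refine ⟨u' * g, ?_⟩
  have h1 : a - θ (u' * g) = -(θ (u' * u - 1) * a) := by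
    rw [map_mul, ← hg, map_sub, map_mul, map_one]
    ring
  rw [h1, ← hθ.map_varPowIdeal]
  exact neg_mem (Ideal.mul_mem_right _ _ (Ideal.mem_map_of_mem _ hu'))

-- The kernel of `θ` is locally `(Y_v : v ∈ s)`, and the denominators are invertible modulo
-- `(x_v^(p^e))`, so they can be cleared.
omit [CharP K p] in
theorem mem_frobeniusPower_iff (hθ : IsLocalPresentation θ) (hY : ∀ u, constantCoeff (Y u) = 0)
    (hdet : (jacobianMatrix Y).det ≠ 0) (hs : ∀ v ∈ s, θ (Y v) = 0)
    (hA : ((Fintype.card σ - s.card : ℕ) : WithBot ℕ∞) ≤ ringKrullDim A) (e : ℕ)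
    (g : MvPolynomial σ K) : θ g ∈ frobeniusPower (maximalIdeal A) (p ^ e) ↔
      g ∈ varPowIdeal σ K (p ^ e) ⊔ Ideal.span (Y '' (s : Set σ)) := by
  rw [← hθ.map_varPowIdeal]
  constructor
  · intro hg
    obtain ⟨u, hu, j, hj, huj⟩ := hθ.exists_mul_eq_of_mem_map hg
    rw [← map_mul, ← sub_eq_zero, ← map_sub] at huj
    obtain ⟨v, hv, hmem⟩ := hθ.exists_mul_mem_span hY hdet hs hA huj
    obtain ⟨w, hw⟩ := exists_mul_sub_one_mem_varPowIdeal (u := v * u) (p ^ e) (by simp [hu, hv])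
    have h1 : g = w * (v * (u * g - j)) + (w * v) * j - (w * (v * u) - 1) * g := by ring
    rw [h1]
    refine sub_mem (add_mem (Ideal.mem_sup_right (Ideal.mul_mem_left _ _ hmem))
      (Ideal.mem_sup_left (Ideal.mul_mem_left _ _ hj)))
      (Ideal.mem_sup_left (Ideal.mul_mem_right _ _ hw))
  · intro hg
    obtain ⟨a, ha, b, hb, rfl⟩ := Submodule.mem_sup.1 hg
    have hb0 : Ideal.span (Y '' (s : Set σ)) ≤ RingHom.ker θ := by
      rw [Ideal.span_le]
      rintro _ ⟨v, hv, rfl⟩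
      exact hs v hv
    rw [map_add, RingHom.mem_ker.1 (hb0 hb), add_zero]
    exact Ideal.mem_map_of_mem _ ha

/-- Under a local presentation, the `F`-pure threshold is the supremum of the weights of mixed
powers outside `(x_v ^ q)`. -/
theorem fpt_eq {ι : Type*} [Fintype ι] (hθ : IsLocalPresentation θ)
    (hY : ∀ u, constantCoeff (Y u) = 0)
    (hdet : (jacobianMatrix Y).det ≠ 0) (hs : ∀ v ∈ s, θ (Y v) = 0)
    (hA : ((Fintype.card σ - s.card : ℕ) : WithBot ℕ∞) ≤ ringKrullDim A)
    {f : ι → MvPolynomial σ K} (hf : ∀ j, constantCoeff (f j) = 0) {v : ℝ}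
    (hv : IsLUB (mixedValues p (∏ v ∈ s, Y v) f) v) :
    fpt p (Ideal.span (Set.range fun j => θ (f j))) = ENNReal.ofReal v := by
  have := hθ.isNoetherianRing
  have hker := hθ.mem_frobeniusPower_iff (p := p) hY hdet hs hA
  refine (hasFrobeniusColon_of_chart hY hdet hθ.exists_sub_mem_frobeniusPower hker).fpt_eq ?_
  rwa [noncontainmentValues_eq_mixedValues hY hdet hker hf]

end IsLocalPresentation

end Presentation

end FThreshold

namespace FThreshold

/-! ### Selecting coordinates by the Jacobian criterion -/

open IsLocalRing MvPolynomial

section Selection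

/-- Among the vectors `a g` and the standard basis vectors there is a basis which contains
a basis of the span of the `a g`. -/
theorem exists_basis_selection {κ σ K : Type*} [Fintype σ] [DecidableEq σ] [Field K]
    (a : κ → σ → K) : ∃ τ : σ → κ ⊕ σ,
      (Matrix.of fun u => Sum.elim a (fun v => Pi.single v 1) (τ u)).det ≠ 0 ∧
      Module.finrank K (Submodule.span K (Set.range a)) ≤
        (Finset.univ.filter fun u => (τ u).isLeft).card := by
  classical
  set v : κ ⊕ σ → σ → K := Sum.elim a fun v => Pi.single v 1 with hv
  -- A maximal independent family is taken among the `a g` first, and only then completed by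
  -- standard basis vectors.
  obtain ⟨b₁, hb₁, -, hspan₁, hli₁⟩ := exists_linearIndepOn_extension (K := K) (v := v)
    (linearIndepOn_empty K v) (Set.empty_subset (Set.range Sum.inl))
  obtain ⟨b₂, -, hb₂, hspan₂, hli₂⟩ := exists_linearIndepOn_extension hli₁ (Set.subset_univ b₁)
  have htop : ⊤ ≤ Submodule.span K (Set.range fun i : b₂ => v i) := by
    rw [← (Pi.basisFun K σ).span_eq, Submodule.span_le]
    rintro _ ⟨i, rfl⟩
    have := hspan₂ (Set.mem_image_of_mem v (Set.mem_univ (Sum.inr i)))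
    rw [Set.image_eq_range] at this
    simpa [hv] using! this
  let b := Module.Basis.mk hli₂ htop
  let e := (Pi.basisFun K σ).indexEquiv b
  refine ⟨fun u => (e u).1, ?_, ?_⟩
  · rw [← isUnit_iff_ne_zero, ← Matrix.isUnit_iff_isUnit_det,
      ← Matrix.linearIndependent_rows_iff_isUnit]
    exact hli₂.comp e e.injective
  · set F := Finset.univ.filter fun u => ((e u).1).isLeft
    have hle : Submodule.span K (Set.range a) ≤
        Submodule.span K ((F.image fun u => v (e u).1 : Finset (σ → K)) : Set (σ → K)) := by
      rw [Submodule.span_le]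
      rintro _ ⟨g, rfl⟩
      refine Submodule.span_mono ?_ (hspan₁ (Set.mem_image_of_mem v (Set.mem_range_self g)))
      rintro _ ⟨i, hi, rfl⟩
      refine Finset.mem_coe.2 (Finset.mem_image.2 ⟨e.symm ⟨i, hb₂ hi⟩, ?_, by simp⟩)
      obtain ⟨g, rfl⟩ := hb₁ hi
      simp [F]
    exact (Submodule.finrank_mono hle).trans
      ((finrank_span_finset_le_card _).trans Finset.card_image_le)

variable {σ K A : Type*} [Field K]

variable (σ K) in
/-- The linear part of a polynomial. -/
noncomputable def linearPart : MvPolynomial σ K →ₗ[K] σ → K :=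
  LinearMap.pi fun v => lcoeff K (Finsupp.single v 1)

@[simp] theorem linearPart_apply (f : MvPolynomial σ K) (v : σ) :
    linearPart σ K f v = coeff (Finsupp.single v 1) f := rfl

theorem linearPart_mul (f g : MvPolynomial σ K) : linearPart σ K (f * g) =
    constantCoeff f • linearPart σ K g + constantCoeff g • linearPart σ K f := by
  classical
  ext v
  rw [linearPart_apply, coeff_mul, Finsupp.antidiagonal_single]
  simp [Finset.Nat.antidiagonal_succ, constantCoeff_eq, mul_comm]

theorem linearPart_mem_span_of_mem {κ : Type*} {G : κ → MvPolynomial σ K}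
    (hG : ∀ g, constantCoeff (G g) = 0) {f : MvPolynomial σ K}
    (hf : f ∈ Ideal.span (Set.range G)) :
    linearPart σ K f ∈ Submodule.span K (Set.range fun g => linearPart σ K (G g)) ∧
      constantCoeff f = 0 := by
  induction hf using Submodule.span_induction with
  | mem x hx =>
    obtain ⟨g, rfl⟩ := hx
    exact ⟨Submodule.subset_span ⟨g, rfl⟩, hG g⟩
  | zero => simp
  | add x y _ _ hx hy =>
    rw [map_add, map_add, hx.2, hy.2, add_zero]
    exact ⟨add_mem hx.1 hy.1, rfl⟩
  | smul b x _ hx =>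
    rw [smul_eq_mul, linearPart_mul, map_mul, hx.2, zero_smul, add_zero, mul_zero]
    exact ⟨Submodule.smul_mem _ _ hx.1, rfl⟩

variable [Fintype σ] [DecidableEq σ] [CommRing A] [IsLocalRing A] {θ : MvPolynomial σ K →+* A}

namespace IsLocalPresentation

/-- The number of variables is at most the rank of the linear parts of the equations plus
the embedding dimension. -/
theorem card_le_finrank_add (hθ : IsLocalPresentation θ) {κ : Type*} {G : κ → MvPolynomial σ K}
    (hG : ∀ g, constantCoeff (G g) = 0)
    (hker : ∀ f, θ f = 0 → ∃ u, constantCoeff u ≠ 0 ∧ u * f ∈ Ideal.span (Set.range G)) :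
    Fintype.card σ ≤
      Module.finrank K (Submodule.span K (Set.range fun g => linearPart σ K (G g))) +
        (maximalIdeal A).spanFinrank := by
  classical
  have := hθ.isNoetherianRing
  obtain ⟨s, hs, hspan⟩ :=
    (IsNoetherian.noetherian (maximalIdeal A)).exists_span_finset_card_eq_spanFinrank
  choose u g hu hg using hθ.exists_mul_eq
  have hs0 : ∀ a ∈ s, constantCoeff (g a) = 0 := fun a ha => by
    by_contra hne
    have h1 := (hθ.isUnit_iff _).2 hne
    rw [← hg a] at h1
    exact (mem_maximalIdeal _).1 (hspan ▸ Submodule.subset_span (Finset.mem_coe.2 ha))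
      (isUnit_of_mul_isUnit_right h1)
  set J := Ideal.span (Set.range fun a : s => g a)
  have hmap : maximalIdeal A ≤ J.map θ := by
    rw [← hspan]
    refine Ideal.span_le.2 fun a ha => ?_
    refine (Ideal.unit_mul_mem_iff_mem _ ((hθ.isUnit_iff _).2 (hu a))).1 ?_
    rw [hg]
    exact Ideal.mem_map_of_mem _ (Ideal.subset_span ⟨⟨a, ha⟩, rfl⟩)
  set W := Submodule.span K (Set.range fun g => linearPart σ K (G g))
  set V := Submodule.span K (Set.range fun a : s => linearPart σ K (g a))
  -- Up to units and the kernel of `θ`, each variable is a combination of lifted generators of the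
  -- maximal ideal; linear parts are compared.
  have htop : W ⊔ V = ⊤ := by
    rw [eq_top_iff, ← (Pi.basisFun K σ).span_eq, Submodule.span_le]
    rintro _ ⟨i, rfl⟩
    have hXi : θ (X i) ∈ maximalIdeal A := by
      rw [mem_maximalIdeal, mem_nonunits_iff, hθ.isUnit_iff]
      simp
    obtain ⟨c, hc, j, hj, hcj⟩ := hθ.exists_mul_eq_of_mem_map (hmap hXi)
    rw [← map_mul, ← sub_eq_zero, ← map_sub] at hcj
    obtain ⟨w, hw, hmem⟩ := hker _ hcj
    have h1 := linearPart_mem_span_of_mem (fun a : s => hs0 a a.2) hj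
    have h2 := (linearPart_mem_span_of_mem hG hmem).1
    have h3 : linearPart σ K (X i) = Pi.single i 1 := by
      ext v
      rw [linearPart_apply, coeff_X, Pi.single_apply]
      simp only [(Finsupp.single_left_injective one_ne_zero).eq_iff, eq_comm]
    have h6 : constantCoeff (c * X i - j) = 0 := by simp [h1.2]
    rw [linearPart_mul, h6, zero_smul, add_zero, map_sub, linearPart_mul, constantCoeff_X,
      zero_smul, add_zero, h3] at h2
    have h4 := (Submodule.smul_mem_iff _ hw).1 h2
    have h5 : constantCoeff c • (Pi.single i 1 : σ → K) ∈ W ⊔ V := by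
      rw [← sub_add_cancel (constantCoeff c • (Pi.single i 1 : σ → K)) (linearPart σ K j)]
      exact add_mem (Submodule.mem_sup_left h4) (Submodule.mem_sup_right h1.1)
    rw [Pi.basisFun_apply]
    exact (Submodule.smul_mem_iff _ hc).1 h5
  have h1 := Submodule.finrank_add_le_finrank_add_finrank W V
  rw [htop, finrank_top, Module.finrank_fintype_fun_eq_card] at h1
  refine h1.trans (Nat.add_le_add_left ((finrank_range_le_card _).trans ?_) _)
  rw [Fintype.card_coe, hs]

-- `A` is a localization of `K[x]/ker θ`, so contraction of primes is strictly monotone.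
omit [Fintype σ] [DecidableEq σ] [IsLocalRing A] in
theorem ringKrullDim_le_quotient_ker (hθ : IsLocalPresentation θ) :
    ringKrullDim A ≤ ringKrullDim (MvPolynomial σ K ⧸ RingHom.ker θ) := by
  let θ' := RingHom.kerLift θ
  refine Order.krullDim_le_of_strictMono (PrimeSpectrum.comap θ') ?_
  intro P Q hPQ
  refine lt_of_le_not_ge (fun x hx => hPQ.le hx) fun hle => hPQ.not_ge fun a ha => ?_
  obtain ⟨u, g, hu, hg⟩ := hθ.exists_mul_eq a
  have h1 : θ g ∈ P.asIdeal := by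
    have h2 : Ideal.Quotient.mk _ g ∈ (PrimeSpectrum.comap θ' Q).asIdeal := by
      change θ g ∈ Q.asIdeal
      rw [← hg]
      exact Ideal.mul_mem_left _ _ ha
    exact hle h2
  rw [← hg] at h1
  exact (Ideal.unit_mul_mem_iff_mem _ ((hθ.isUnit_iff u).2 hu)).1 h1

end IsLocalPresentation

theorem isDomain_of_isRegularLocalRing (A : Type*) [CommRing A] [IsRegularLocalRing A] :
    IsDomain A := by
  obtain ⟨s, hs, hspan⟩ :=
    (IsNoetherian.noetherian (maximalIdeal A)).exists_span_finset_card_eq_spanFinrank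
  refine isDomain_of_card_le_ringKrullDim _ hs.le hspan ?_
  rw [IsRegularLocalRing.spanFinrank_maximalIdeal]

theorem height_add_ringKrullDim_quotient_le {R : Type*} [CommRing R] (P : Ideal R) [P.IsPrime] :
    (P.height : WithBot ℕ∞) + ringKrullDim (R ⧸ P) ≤ ringKrullDim R := by
  have : Nonempty (PrimeSpectrum R) := ⟨⟨P, ‹_›⟩⟩
  have h1 : ringKrullDim (R ⧸ P) = Order.coheight (⟨P, ‹_›⟩ : PrimeSpectrum R) := by
    have h2 : PrimeSpectrum.zeroLocus (P : Set R) = Set.Ici (⟨P, ‹_›⟩ : PrimeSpectrum R) := by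
      ext
      rfl
    rw [ringKrullDim_quotient, Order.coheight_eq_krullDim_Ici, h2]
  have h2 : P.height = Order.height (⟨P, ‹_›⟩ : PrimeSpectrum R) :=
    PrimeSpectrum.height_eq_orderHeight ⟨P, ‹_›⟩
  rw [h1, h2, ringKrullDim, Order.krullDim_eq_iSup_height_add_coheight_of_nonempty]
  rw [← WithBot.coe_add, WithBot.coe_le_coe]
  exact le_iSup (fun a : PrimeSpectrum R => Order.height a + Order.coheight a) ⟨P, ‹_›⟩

namespace IsLocalPresentation

omit [Fintype σ] in
theorem jacobianMatrix_selection {κ : Type*} (G : κ → MvPolynomial σ K) (τ : σ → κ ⊕ σ) :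
    jacobianMatrix (fun u => Sum.elim G X (τ u)) = Matrix.of fun u =>
      Sum.elim (fun g => linearPart σ K (G g)) (fun v => Pi.single v 1) (τ u) := by
  ext u v
  rw [jacobianMatrix, Matrix.of_apply]
  rcases τ u with g | w
  · rfl
  · rw [Sum.elim_inr, Sum.elim_inr, coeff_X, Pi.single_apply]
    simp only [(Finsupp.single_left_injective one_ne_zero).eq_iff, eq_comm]

variable [IsRegularLocalRing A] {κ : Type*} {G : κ → MvPolynomial σ K}

omit [IsLocalRing A] in
theorem exists_selection (hθ : IsLocalPresentation θ)
    (hG : ∀ g, constantCoeff (G g) = 0)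
    (hker : ∀ f, θ f = 0 → ∃ u, constantCoeff u ≠ 0 ∧ u * f ∈ Ideal.span (Set.range G)) :
    ∃ τ : σ → κ ⊕ σ, (jacobianMatrix fun u => Sum.elim G X (τ u)).det ≠ 0 ∧
      ((Fintype.card σ - (Finset.univ.filter fun u => (τ u).isLeft).card : ℕ) : WithBot ℕ∞) ≤
        ringKrullDim A := by
  obtain ⟨τ, hdet, hle⟩ := exists_basis_selection fun g => linearPart σ K (G g)
  refine ⟨τ, by rwa [jacobianMatrix_selection], ?_⟩
  rw [← IsRegularLocalRing.spanFinrank_maximalIdeal, Nat.cast_le]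
  have := hθ.card_le_finrank_add hG hker
  omega

-- The selected equations give `|s| ≤ ht(ker θ) ≤ |σ| - d`, while `|σ| - |s| ≤ dim A` by the choice
-- of the selection. With this bound, a selection made at another prime can be used for `A`.
omit [IsLocalRing A] in
theorem le_ringKrullDim (hθ : IsLocalPresentation θ)
    (hG : ∀ g, constantCoeff (G g) = 0) (hG0 : ∀ g, θ (G g) = 0)
    (hker : ∀ f, θ f = 0 → ∃ u, constantCoeff u ≠ 0 ∧ u * f ∈ Ideal.span (Set.range G))
    (d : ℕ) (hd : ringKrullDim (MvPolynomial σ K ⧸ RingHom.ker θ) = d) :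
    (d : WithBot ℕ∞) ≤ ringKrullDim A := by
  have := isDomain_of_isRegularLocalRing A
  have := RingHom.ker_isPrime θ
  obtain ⟨τ, hdet, hle⟩ := hθ.exists_selection hG hker
  set s := Finset.univ.filter fun u => (τ u).isLeft
  have h1 := hθ.card_le_height_ker (s := s) (fun u => ?_) hdet (fun u hu => ?_) hle
  · have h2 := height_add_ringKrullDim_quotient_le (RingHom.ker θ)
    rw [hd, MvPolynomial.ringKrullDim_of_isNoetherianRing, ringKrullDim_eq_zero_of_field, zero_add,
      Nat.card_eq_fintype_card] at h2
    have h3 : ((s.card : ℕ∞) : WithBot ℕ∞) + d ≤ (Fintype.card σ : ℕ) :=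
      (add_le_add_left (WithBot.coe_le_coe.2 h1) _).trans h2
    have h4 : s.card + d ≤ Fintype.card σ := by exact_mod_cast h3
    refine le_trans (Nat.cast_le.2 ?_) hle
    omega
  · rcases τ u with g | w
    · exact hG g
    · exact constantCoeff_X _ _
  · obtain ⟨g, hg⟩ := Sum.isLeft_iff.1 (Finset.mem_filter.1 hu).2
    rw [hg]
    exact hG0 g

end IsLocalPresentation

end Selection

end FThreshold

namespace FThreshold

/-! ### Localizations of fiber rings -/

open IsLocalRing MvPolynomial

section LocalizationPresentation

variable {σ K T A : Type*} [Field K] [CommRing T] [CommRing A] [Algebra T A] {n : Ideal T}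
  [n.IsPrime] [IsLocalization.AtPrime A n] {π : MvPolynomial σ K →+* T}

include n in
theorem isLocalPresentation_of_atPrime (hπ : Function.Surjective π) (hX : ∀ v, π (X v) ∈ n) :
    IsLocalPresentation ((algebraMap T A).comp π) := by
  have := IsLocalization.AtPrime.isLocalRing A n
  have hn : ∀ t, IsUnit (algebraMap T A t) ↔ t ∉ n := fun t =>
    IsLocalization.AtPrime.isUnit_to_map_iff A n t
  have hunit : ∀ u, IsUnit ((algebraMap T A).comp π u) ↔ constantCoeff u ≠ 0 := by
    intro u
    have h1 : π (u - C (constantCoeff u)) ∈ n := by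
      have : idealOfVars σ K ≤ n.comap π := by
        rw [idealOfVars, Ideal.span_le]
        rintro _ ⟨v, rfl⟩
        exact hX v
      exact this (mem_idealOfVars_iff.2 (by simp))
    rw [RingHom.comp_apply, hn, ← sub_add_cancel u (C (constantCoeff u)), map_add,
      Ideal.add_mem_iff_right _ h1, sub_add_cancel, not_iff_not]
    constructor
    · intro h
      by_contra hne
      refine ‹n.IsPrime›.ne_top (Ideal.eq_top_of_isUnit_mem _ h ?_)
      exact ((isUnit_iff_ne_zero.2 hne).map C).map π
    · intro h
      rw [h, C_0, map_zero]
      exact zero_mem _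
  refine ⟨hunit, fun a => ?_⟩
  obtain ⟨⟨t, s⟩, hts⟩ := IsLocalization.surj n.primeCompl a
  obtain ⟨u, hu⟩ := hπ s
  obtain ⟨g, rfl⟩ := hπ t
  refine ⟨u, g, (hunit u).1 ?_, ?_⟩
  · rw [RingHom.comp_apply, hu, hn]
    exact s.2
  · rw [RingHom.comp_apply, hu, mul_comm]
    exact hts

include n in
theorem exists_mul_mem_ker (hπ : Function.Surjective π) (hX : ∀ v, π (X v) ∈ n)
    {f : MvPolynomial σ K} (hf : (algebraMap T A).comp π f = 0) :
    ∃ u, constantCoeff u ≠ 0 ∧ u * f ∈ RingHom.ker π := by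
  obtain ⟨s, hs⟩ := (IsLocalization.map_eq_zero_iff n.primeCompl A _).1 hf
  obtain ⟨u, hu⟩ := hπ s
  refine ⟨u, ((isLocalPresentation_of_atPrime (A := A) hπ hX).isUnit_iff u).1 ?_, ?_⟩
  · rw [RingHom.comp_apply, hu]
    exact IsLocalization.map_units A s
  · rw [RingHom.mem_ker, map_mul, hu, hs]

-- As `A` is a domain, the kernel of `T → A` is a minimal prime of `T`, so it computes the dimension
-- of a component.
include n in
theorem ringKrullDim_quotient_ker [IsDomain A] (hπ : Function.Surjective π) {d : ℕ}
    (hd : HasPureDimension T d) :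
    ringKrullDim (MvPolynomial σ K ⧸ RingHom.ker ((algebraMap T A).comp π)) = d := by
  have hP : RingHom.ker (algebraMap T A) ∈ minimalPrimes T := by
    refine ⟨⟨RingHom.ker_isPrime _, bot_le⟩, fun P hP hle t ht => ?_⟩
    have := hP.1
    obtain ⟨s, hs⟩ := (IsLocalization.map_eq_zero_iff n.primeCompl A t).1 ht
    have h1 : (s : T) * t ∈ P := hs ▸ zero_mem P
    refine (hP.1.mem_or_mem h1).resolve_left fun h2 => ?_
    have h3 : algebraMap T A s = 0 := hle h2
    exact (IsLocalization.map_units A s).ne_zero h3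
  rw [← hd _ hP]
  have hker : RingHom.ker ((algebraMap T A).comp π) =
      RingHom.ker ((Ideal.Quotient.mk (RingHom.ker (algebraMap T A))).comp π) := by
    ext f
    rw [RingHom.mem_ker, RingHom.mem_ker, RingHom.comp_apply, RingHom.comp_apply,
      Ideal.Quotient.eq_zero_iff_mem, RingHom.mem_ker]
  rw [hker]
  exact ringKrullDim_eq_of_ringEquiv (RingHom.quotientKerEquivOfSurjective
    (Ideal.Quotient.mk_surjective.comp hπ))

end LocalizationPresentation

section Fiber

open TensorProduct

variable {R S : Type*} [CommRing R] [CommRing S] [Algebra R S]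

theorem exists_fiber_localization (q : Ideal R) [q.IsPrime] (q' : Ideal S) [hq' : q'.IsPrime]
    (h : q'.comap (algebraMap R S) = q) :
    ∃ (n : Ideal (q.Fiber S)) (_ : n.IsPrime) (e : Localization.AtPrime n ≃+* LocalFiber q q'),
      (∀ s : S, (1 : q.ResidueField) ⊗ₜ[R] s ∈ n ↔ s ∈ q') ∧
      ∀ s : S, e (algebraMap _ _ ((1 : q.ResidueField) ⊗ₜ[R] s)) =
        Ideal.Quotient.mk _ (algebraMap S _ s) := by
  -- The prime `n` of the fiber ring is the one corresponding to `𝔮'`, which lies over `𝔮`.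
  let x : PrimeSpectrum.comap (algebraMap R S) ⁻¹' {⟨q, ‹_›⟩} := ⟨⟨q', hq'⟩, PrimeSpectrum.ext h⟩
  let n := (PrimeSpectrum.preimageEquivFiber R S ⟨q, ‹_›⟩ x)
  have hn : q' = n.asIdeal.comap Algebra.TensorProduct.includeRight := by
    have := congrArg (fun y => y.1.asIdeal)
      ((PrimeSpectrum.preimageEquivFiber R S ⟨q, ‹_›⟩).symm_apply_apply x)
    exact this.symm
  clear_value n
  subst hn
  refine ⟨n.asIdeal, n.2, (Ideal.Fiber.algEquivAux₂ q n.asIdeal).toRingEquiv, fun s => Iff.rfl,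
    fun s => ?_⟩
  let : Algebra S (q.Fiber S) := Algebra.TensorProduct.rightAlgebra
  let r : Ideal S := n.asIdeal.comap Algebra.TensorProduct.includeRight
  have h1 : Ideal.Fiber.algEquivAux₂ q n.asIdeal (algebraMap S (Localization.AtPrime n.asIdeal) s) =
      algebraMap (S ⧸ q.map (algebraMap R S)) (Localization.AtPrime r ⧸
        (q.map (algebraMap R S)).map (algebraMap S (Localization.AtPrime r)))
          (Ideal.Quotient.mk (q.map (algebraMap R S)) s) := by
    unfold Ideal.Fiber.algEquivAux₂
    rw [AlgEquiv.trans_apply, AlgEquiv.restrictScalars_apply, AlgEquiv.restrictScalars_apply]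
    erw [AlgEquiv.commutes]
    rw [show algebraMap S (Localization.AtPrime
      (Ideal.comap (Ideal.Fiber.algEquivAux₁ q).symm n.asIdeal)) s =
        algebraMap (S ⧸ q.map (algebraMap R S)) _ (Ideal.Quotient.mk _ s) from rfl,
      AlgEquiv.commutes]
  exact h1

end Fiber

end FThreshold

namespace FThreshold

/-! ### Presentations adapted to the retraction and their base change -/

open IsLocalRing MvPolynomial TensorProduct

section Presentation

variable {R S : Type*} [CommRing R] [CommRing S] [Algebra R S]

/-- An algebra of finite type with a retraction has a presentation whose variables are killed by
the retraction. -/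
theorem exists_presentation [IsNoetherianRing R] [Algebra.FiniteType R S] (φ : S →+* R)
    (hφ : φ.comp (algebraMap R S) = RingHom.id R) :
    ∃ (N : ℕ) (π : MvPolynomial (Fin N) R →ₐ[R] S) (m : ℕ) (G : Fin m → MvPolynomial (Fin N) R),
      Function.Surjective π ∧ (∀ v, φ (π (X v)) = 0) ∧
      RingHom.ker π = Ideal.span (Set.range G) := by
  have hφ' : ∀ r, φ (algebraMap R S r) = r := fun r => RingHom.congr_fun hφ r
  obtain ⟨N, f, hf⟩ := Algebra.FiniteType.iff_quotient_mvPolynomial''.1 ‹Algebra.FiniteType R S›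
  -- Each generator is translated by its image under `φ`, which moves the section to the origin.
  let π : MvPolynomial (Fin N) R →ₐ[R] S :=
    aeval fun v => f (X v) - algebraMap R S (φ (f (X v)))
  obtain ⟨m, G, hG⟩ :=
    Submodule.fg_iff_exists_fin_generating_family.1 (IsNoetherian.noetherian (RingHom.ker π))
  refine ⟨N, π, m, G, fun s => ?_, fun v => ?_, hG.symm⟩
  · obtain ⟨g, rfl⟩ := hf s
    refine ⟨aeval (fun v => X v + C (φ (f (X v)))) g, ?_⟩
    have : π.comp (aeval fun v => X v + C (φ (f (X v)))) = f := by
      ext v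
      simp [π, algHom_C]
    exact DFunLike.congr_fun this g
  · simp [π, hφ']

variable {σ : Type*} (π : MvPolynomial σ R →ₐ[R] S)

theorem apply_eq_constantCoeff {φ : S →+* R} (hφ : φ.comp (algebraMap R S) = RingHom.id R)
    (hπ : ∀ v, φ (π (X v)) = 0) (F : MvPolynomial σ R) : φ (π F) = constantCoeff F := by
  have : φ.comp (π : MvPolynomial σ R →+* S) = constantCoeff := by
    refine MvPolynomial.ringHom_ext (fun r => ?_) fun v => ?_
    · rw [constantCoeff_C, RingHom.comp_apply, RingHom.coe_coe, algHom_C]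
      exact RingHom.congr_fun hφ r
    · rw [constantCoeff_X]
      exact hπ v
  exact RingHom.congr_fun this F

variable (K : Type*) [CommRing K] [Algebra R K]

/-- The base change of a presentation. -/
noncomputable def baseChangePresentation : MvPolynomial σ K →ₐ[K] K ⊗[R] S :=
  (Algebra.TensorProduct.map (AlgHom.id K K) π).comp
    (algebraTensorAlgEquiv R K).symm.toAlgHom

theorem baseChangePresentation_map (F : MvPolynomial σ R) :
    baseChangePresentation π K (map (algebraMap R K) F) = 1 ⊗ₜ π F := by
  simp [baseChangePresentation, algebraTensorAlgEquiv_symm_map]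

theorem baseChangePresentation_X (v : σ) :
    baseChangePresentation π K (X v) = 1 ⊗ₜ π (X v) := by
  rw [← baseChangePresentation_map, map_X]

variable {π}

theorem baseChangePresentation_surjective (hπ : Function.Surjective π) :
    Function.Surjective (baseChangePresentation π K) :=
  (Algebra.TensorProduct.map_surjective _ _ Function.surjective_id hπ).comp
    (algebraTensorAlgEquiv R K).symm.surjective

/-- Right exactness of the tensor product: the same equations present the base change. -/
theorem ker_baseChangePresentation (hπ : Function.Surjective π) {κ : Type*}
    {G : κ → MvPolynomial σ R} (hG : RingHom.ker π = Ideal.span (Set.range G)) :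
    RingHom.ker (baseChangePresentation π K) =
      Ideal.span (Set.range fun g => map (algebraMap R K) (G g)) := by
  ext f
  have h1 : f ∈ RingHom.ker (baseChangePresentation π K) ↔
      (algebraTensorAlgEquiv R K).symm f ∈
        RingHom.ker (Algebra.TensorProduct.map (AlgHom.id R K) π) := Iff.rfl
  rw [h1, Algebra.TensorProduct.lTensor_ker _ hπ, hG]
  have h2 : Ideal.span (Set.range fun g => map (algebraMap R K) (G g)) =
      ((Ideal.span (Set.range G)).map
        (Algebra.TensorProduct.includeRight : _ →ₐ[R] K ⊗[R] MvPolynomial σ R)).map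
          (algebraTensorAlgEquiv (σ := σ) R K) := by
    rw [Ideal.map_span, Ideal.map_span, ← Set.range_comp, ← Set.range_comp]
    simp [Function.comp_def, algebraTensorAlgEquiv_tmul]
  rw [h2, Ideal.mem_map_of_equiv]
  exact ⟨fun h => ⟨_, h, AlgEquiv.apply_symm_apply _ _⟩, by rintro ⟨x, hx, rfl⟩; simpa using hx⟩

end Presentation

section LocalFiber

variable {R S σ κ : Type*} [CommRing R] [CommRing S] [Algebra R S]
  {π : MvPolynomial σ R →ₐ[R] S} {G : κ → MvPolynomial σ R} {φ : S →+* R}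

theorem exists_localFiber_presentation (hφ : φ.comp (algebraMap R S) = RingHom.id R)
    (hπ : Function.Surjective π) (hX : ∀ v, φ (π (X v)) = 0)
    (hG : RingHom.ker π = Ideal.span (Set.range G)) (q : Ideal R) [q.IsPrime] {d : ℕ}
    [IsRegularRing (q.Fiber S)] (hd : HasPureDimension (q.Fiber S) d) :
    ∃ θ : MvPolynomial σ q.ResidueField →+* LocalFiber q (q.comap φ), IsLocalPresentation θ ∧
      (∀ F, θ (map (algebraMap R _) F) = Ideal.Quotient.mk _ (algebraMap S _ (π F))) ∧
      IsRegularLocalRing (LocalFiber q (q.comap φ)) ∧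
      (∀ f, θ f = 0 → ∃ u, constantCoeff u ≠ 0 ∧
        u * f ∈ Ideal.span (Set.range fun g => map (algebraMap R q.ResidueField) (G g))) ∧
      ringKrullDim (MvPolynomial σ q.ResidueField ⧸ RingHom.ker θ) = d := by
  have hcomap : (q.comap φ).comap (algebraMap R S) = q := by
    rw [Ideal.comap_comap, hφ, Ideal.comap_id]
  obtain ⟨n, hn, e, hmem, he⟩ := exists_fiber_localization q (q.comap φ) hcomap
  have hreg : IsRegularLocalRing (LocalFiber q (q.comap φ)) := 
    IsRegularLocalRing.of_ringEquiv (R := Localization.AtPrime n) e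
  let : Algebra (q.Fiber S) (LocalFiber q (q.comap φ)) :=
    (e.toRingHom.comp (algebraMap (q.Fiber S) (Localization.AtPrime n))).toAlgebra
  have hloc : IsLocalization.AtPrime (LocalFiber q (q.comap φ)) n :=
    IsLocalization.isLocalization_of_algEquiv n.primeCompl
      (AlgEquiv.ofRingEquiv (f := e) fun _ => rfl :
        Localization.AtPrime n ≃ₐ[q.Fiber S] LocalFiber q (q.comap φ))
  let ρ : MvPolynomial σ q.ResidueField →+* q.Fiber S := baseChangePresentation π q.ResidueField
  have hρ : Function.Surjective ρ := baseChangePresentation_surjective _ hπ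
  have hρX : ∀ v, ρ (X v) ∈ n := fun v => by
    have h1 : ρ (X v) = 1 ⊗ₜ π (X v) := baseChangePresentation_X π _ v
    rw [h1, hmem, Ideal.mem_comap, hX]
    exact zero_mem _
  have := isDomain_of_isRegularLocalRing (LocalFiber q (q.comap φ))
  refine ⟨(algebraMap (q.Fiber S) (LocalFiber q (q.comap φ))).comp ρ,
    isLocalPresentation_of_atPrime hρ hρX, fun F => ?_, hreg, fun f hf => ?_,
    ringKrullDim_quotient_ker (n := n) hρ hd⟩
  · rw [← he]
    exact congrArg (fun t => e (algebraMap (q.Fiber S) (Localization.AtPrime n) t))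
      (baseChangePresentation_map π _ F)
  · rw [← ker_baseChangePresentation _ hπ hG]
    exact exists_mul_mem_ker hρ hρX hf

end LocalFiber

end FThreshold

namespace FThreshold

/-! ### Openness -/

open IsLocalRing MvPolynomial TensorProduct

section Values

variable {σ ι K : Type*} [Finite σ] [Fintype ι] [Field K] {p : ℕ} [Fact p.Prime]

omit [Finite σ] in
theorem exists_isLUB_mixedValues (y : MvPolynomial σ K) (f : ι → MvPolynomial σ K) :
    ∃ v, IsLUB (mixedValues p y f) v := by
  refine Real.exists_isLUB ⟨0, 0, 0, 0, by simp, by simp, ?_, by simp⟩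
    ⟨Fintype.card ι, fun x hx => (le_of_mem_mixedValues hx).2⟩
  simp [mixedPower]

theorem totalDegree_map_le {σ R L : Type*} [CommRing R] [CommRing L] (g : R →+* L)
    (f : MvPolynomial σ R) : (map g f).totalDegree ≤ f.totalDegree :=
  Finset.sup_mono (support_map_subset g f)

theorem exists_lt_forall_le_of_finite {L : Set ℝ} (hL : L.Finite) {c : ℝ} :
    ∃ c' < c, ∀ v ∈ L, c' < v → c ≤ v := by
  have hfin : (insert (c - 1) {v ∈ L | v < c}).Finite := (hL.subset (Set.sep_subset _ _)).insert _
  obtain ⟨c', hc', hmax⟩ := Set.exists_max_image _ id hfin ⟨_, Set.mem_insert _ _⟩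
  refine ⟨c', ?_, fun v hv hlt => ?_⟩
  · rcases hc' with rfl | h
    · exact sub_one_lt c
    · exact h.2
  · by_contra! hvc
    exact hlt.not_ge (hmax v (Set.mem_insert_of_mem _ ⟨hv, hvc⟩))

end Values

section Openness

variable {R S σ κ ι : Type*} [CommRing R] [CommRing S] [Algebra R S] [Fintype σ] [DecidableEq σ]
  [Fintype ι] {π : MvPolynomial σ R →ₐ[R] S} {G : κ → MvPolynomial σ R} {φ : S →+* R}
  {f : ι → MvPolynomial σ R} {p d : ℕ} [Fact p.Prime]

/-- The variables whose coordinate is chosen among the equations. -/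
def equationIndices (τ : σ → κ ⊕ σ) : Finset σ :=
  Finset.univ.filter fun u => (τ u).isLeft

omit [Fintype σ] [DecidableEq σ] in
theorem jacobianMatrix_map {L : Type*} [CommRing L] (g : R →+* L) (Y : σ → MvPolynomial σ R) :
    (jacobianMatrix fun u => map g (Y u)) = (jacobianMatrix Y).map g := by
  ext u v
  simp [jacobianMatrix, coeff_map]

omit [Fintype σ] [DecidableEq σ] in
theorem map_selection {L : Type*} [CommRing L] (g : R →+* L) (G : κ → MvPolynomial σ R)
    (τ : σ → κ ⊕ σ) (u : σ) : map g (Sum.elim G X (τ u)) =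
      Sum.elim (fun k => map g (G k)) X (τ u) := by
  rcases τ u with k | v <;> simp

omit [Fintype σ] [DecidableEq σ] in
theorem constantCoeff_eq_zero_of_ker (hφ : φ.comp (algebraMap R S) = RingHom.id R)
    (hX : ∀ v, φ (π (X v)) = 0) (hG : RingHom.ker π = Ideal.span (Set.range G)) (g : κ) :
    constantCoeff (G g) = 0 := by
  have h : π (G g) = 0 := by
    rw [← RingHom.mem_ker, hG]
    exact Ideal.subset_span ⟨g, rfl⟩
  rw [← apply_eq_constantCoeff π hφ hX, h, map_zero]

theorem exists_selection_localFiber (hφ : φ.comp (algebraMap R S) = RingHom.id R)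
    (hπ : Function.Surjective π) (hX : ∀ v, φ (π (X v)) = 0)
    (hG : RingHom.ker π = Ideal.span (Set.range G)) (q : Ideal R) [q.IsPrime]
    [IsRegularRing (q.Fiber S)] (hd : HasPureDimension (q.Fiber S) d) :
    ∃ τ : σ → κ ⊕ σ, (jacobianMatrix fun u => Sum.elim G X (τ u)).det ∉ q ∧
      Fintype.card σ - (equationIndices τ).card ≤ d := by
  obtain ⟨θ, hθ, -, hreg, hker, hdim⟩ := exists_localFiber_presentation hφ hπ hX hG q hd
  obtain ⟨τ, hdet, hle⟩ := hθ.exists_selection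
    (fun g => by rw [constantCoeff_map, constantCoeff_eq_zero_of_ker hφ hX hG, map_zero]) hker
  refine ⟨τ, fun h => hdet ?_, ?_⟩
  · rw [← Ideal.algebraMap_residueField_eq_zero, RingHom.map_det, RingHom.mapMatrix_apply,
      ← jacobianMatrix_map] at h
    simpa only [map_selection] using h
  · have := (hle.trans hθ.ringKrullDim_le_quotient_ker).trans hdim.le
    exact_mod_cast this

/-- On the locus where the Jacobian determinant of the chosen coordinates does not vanish, the
`F`-pure threshold of the fiber is the supremum of the mixed values. -/
theorem fpt_localFiberIdeal (hφ : φ.comp (algebraMap R S) = RingHom.id R)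
    (hπ : Function.Surjective π) (hX : ∀ v, φ (π (X v)) = 0)
    (hG : RingHom.ker π = Ideal.span (Set.range G)) (hp : (p : R) = 0) (q : Ideal R) [q.IsPrime]
    [IsRegularRing (q.Fiber S)] (hd : HasPureDimension (q.Fiber S) d)
    {τ : σ → κ ⊕ σ} (hdet : (jacobianMatrix fun u => Sum.elim G X (τ u)).det ∉ q)
    (hcard : Fintype.card σ - (equationIndices τ).card ≤ d)
    (hf : ∀ j, π (f j) ∈ q.comap φ) {v : ℝ}
    (hv : IsLUB (mixedValues p
      (map (algebraMap R q.ResidueField) (∏ u ∈ equationIndices τ, Sum.elim G X (τ u)))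
      (fun j => map (algebraMap R q.ResidueField) (f j))) v) :
    fpt p (localFiberIdeal (Ideal.span (Set.range fun j => π (f j))) q (q.comap φ)) =
      ENNReal.ofReal v := by
  obtain ⟨θ, hθ, hθmap, hreg, hker, hdim⟩ := exists_localFiber_presentation hφ hπ hX hG q hd
  have hG0 : ∀ g, constantCoeff (map (algebraMap R q.ResidueField) (G g)) = 0 := fun g => by
    rw [constantCoeff_map, constantCoeff_eq_zero_of_ker hφ hX hG, map_zero]
  have hGθ : ∀ g, θ (map (algebraMap R q.ResidueField) (G g)) = 0 := fun g => by
    have h : π (G g) = 0 := by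
      rw [← RingHom.mem_ker, hG]
      exact Ideal.subset_span ⟨g, rfl⟩
    rw [hθmap, h, map_zero, map_zero]
  have hA := hθ.le_ringKrullDim hG0 hGθ hker d hdim
  have hpK : (p : q.ResidueField) = 0 := by
    rw [← map_natCast (algebraMap R q.ResidueField), hp, map_zero]
  have hpA : (p : LocalFiber q (q.comap φ)) = 0 := by
    rw [← map_natCast (θ.comp C), hpK, map_zero]
  have := (CharP.charP_iff_prime_eq_zero (Fact.out : p.Prime)).2 hpK
  have := (CharP.charP_iff_prime_eq_zero (Fact.out : p.Prime)).2 hpA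
  have hideal : localFiberIdeal (Ideal.span (Set.range fun j => π (f j))) q (q.comap φ) =
      Ideal.span (Set.range fun j => θ (map (algebraMap R q.ResidueField) (f j))) := by
    rw [localFiberIdeal, Ideal.map_span, Ideal.map_span, ← Set.range_comp, ← Set.range_comp]
    simp only [hθmap, Function.comp_def]
  rw [map_prod] at hv
  rw [hideal]
  refine hθ.fpt_eq (s := equationIndices τ) (fun u => ?_) ?_ (fun u hu => ?_)
    ((Nat.cast_le.2 hcard).trans hA) (fun j => ?_) hv
  · rw [map_selection]
    rcases τ u with g | w
    · exact hG0 g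
    · exact constantCoeff_X _ _
  · rw [jacobianMatrix_map, ← RingHom.mapMatrix_apply, ← RingHom.map_det]
    exact fun h => hdet (Ideal.algebraMap_residueField_eq_zero.1 h)
  · obtain ⟨g, hg⟩ := Sum.isLeft_iff.1 (Finset.mem_filter.1 hu).2
    rw [hg]
    exact hGθ g
  · rw [constantCoeff_map, Ideal.algebraMap_residueField_eq_zero, ← apply_eq_constantCoeff π hφ hX]
    exact hf j

theorem isOpen_setOf_le_fpt (hφ : φ.comp (algebraMap R S) = RingHom.id R)
    (hπ : Function.Surjective π) (hX : ∀ v, φ (π (X v)) = 0)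
    (hG : RingHom.ker π = Ideal.span (Set.range G)) (hp : (p : R) = 0)
    (hreg : ∀ q : PrimeSpectrum R, IsRegularRing (q.asIdeal.Fiber S))
    (hd : ∀ q : PrimeSpectrum R, HasPureDimension (q.asIdeal.Fiber S) d)
    (hf : ∀ (q : PrimeSpectrum R) j, π (f j) ∈ q.asIdeal.comap φ) {c : ℝ} (hc : 0 < c) :
    IsOpen {q : PrimeSpectrum R | ENNReal.ofReal c ≤
      fpt p (localFiberIdeal (Ideal.span (Set.range fun j => π (f j))) q.asIdeal
        (q.asIdeal.comap φ))} := by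
  rw [isOpen_iff_mem_nhds]
  intro q₀ hq₀
  obtain ⟨τ, hdet, hcard⟩ := exists_selection_localFiber hφ hπ hX hG q₀.asIdeal (hd q₀)
  set y := ∏ u ∈ equationIndices τ, Sum.elim G X (τ u)
  -- The finite set is the same for all primes, because reduction to a residue field cannot raise
  -- degrees; no possible threshold lies strictly between `c'` and `c`.
  obtain ⟨c', hc', hgap⟩ := exists_lt_forall_le_of_finite (c := c) (possibleThresholds_finite
    (Fact.out : p.Prime) (Fintype.card ι)
      (monomialCount σ (y.totalDegree + ∑ j, (f j).totalDegree) + 2))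
  obtain ⟨v₀, hv₀⟩ := exists_isLUB_mixedValues (p := p)
    (map (algebraMap R q₀.asIdeal.ResidueField) y)
    (fun j => map (algebraMap R q₀.asIdeal.ResidueField) (f j))
  rw [Set.mem_ofPred_eq, fpt_localFiberIdeal hφ hπ hX hG hp q₀.asIdeal (hd q₀) hdet hcard (hf q₀)
    hv₀, ENNReal.ofReal_le_ofReal_iff'] at hq₀
  -- A single nonzero coefficient certifies a value above `c'`. It and the Jacobian determinant stay
  -- nonzero on a neighbourhood, where the threshold then exceeds `c'` and hence is at least `c`.
  obtain ⟨x, ⟨e, i, γ, hi, hγ, hcoeff, rfl⟩, hlt⟩ :=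
    (lt_isLUB_iff hv₀).1 (hc'.trans_le (hq₀.resolve_right hc.not_ge))
  rw [← map_mixedPower, coeff_map, Ne, Ideal.algebraMap_residueField_eq_zero] at hcoeff
  have hmem : ((PrimeSpectrum.basicOpen (jacobianMatrix fun u => Sum.elim G X (τ u)).det ⊓
      PrimeSpectrum.basicOpen (coeff γ (mixedPower p y f e i)) :
        TopologicalSpace.Opens (PrimeSpectrum R)) : Set (PrimeSpectrum R)) ∈ nhds q₀ :=
    (TopologicalSpace.Opens.isOpen _).mem_nhds ⟨hdet, hcoeff⟩
  filter_upwards [hmem]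
  rintro q ⟨hqdet, hqcoeff⟩
  obtain ⟨v, hv⟩ := exists_isLUB_mixedValues (p := p)
    (map (algebraMap R q.asIdeal.ResidueField) y)
    (fun j => map (algebraMap R q.asIdeal.ResidueField) (f j))
  rw [fpt_localFiberIdeal hφ hπ hX hG hp q.asIdeal (hd q) hqdet hcard (hf q) hv]
  have hpK : (p : q.asIdeal.ResidueField) = 0 := by
    rw [← map_natCast (algebraMap R q.asIdeal.ResidueField), hp, map_zero]
  have := (CharP.charP_iff_prime_eq_zero (Fact.out : p.Prime)).2 hpK
  refine ENNReal.ofReal_le_ofReal (hgap v (mem_possibleThresholds ?_ hv) (hlt.trans_le (hv.1 ?_)))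
  · exact add_le_add (totalDegree_map_le _ y)
      (Finset.sum_le_sum fun j _ => totalDegree_map_le _ (f j))
  · refine ⟨e, i, γ, hi, hγ, ?_, rfl⟩
    rw [← map_mixedPower, coeff_map, Ne, Ideal.algebraMap_residueField_eq_zero]
    exact hqcoeff

end Openness

end FThreshold

theorem theorem5p1 {k R S : Type*} [Field k] [CommRing R] [CommRing S]
    (p : ℕ) [Fact p.Prime] [CharP k p]
    (hk : FiniteDimensional (frobenius k p).fieldRange k)
    [Algebra k R] [Algebra k S] [Algebra R S] [IsScalarTower k R S]
    (hR : Algebra.FiniteType k R) (hS : Algebra.FiniteType k S)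
    (d : ℕ)
    (hreg : ∀ q : PrimeSpectrum R, IsRegularRing (q.asIdeal.Fiber S))
    (hdim : ∀ q : PrimeSpectrum R, FThreshold.HasPureDimension (q.asIdeal.Fiber S) d)
    (φ : S →+* R) (hφ : φ.comp (algebraMap R S) = RingHom.id R)
    (𝔞 : Ideal S) (h𝔞 : ∀ q : PrimeSpectrum R, 𝔞 ≤ q.asIdeal.comap φ)
    (c : ℝ) (hc : 0 ≤ c) :
    IsOpen {q : PrimeSpectrum R |
      ENNReal.ofReal c ≤
        FThreshold.fpt p (FThreshold.localFiberIdeal 𝔞 q.asIdeal (q.asIdeal.comap φ))} := by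
  rcases hc.eq_or_lt with rfl | hc
  · simp
  have : IsNoetherianRing R := Algebra.FiniteType.isNoetherianRing k R
  have : IsNoetherianRing S := Algebra.FiniteType.isNoetherianRing k S
  have : Algebra.FiniteType R S := Algebra.FiniteType.of_restrictScalars_finiteType k R S
  have hp : (p : R) = 0 := by rw [← map_natCast (algebraMap k R), CharP.cast_eq_zero, map_zero]
  obtain ⟨N, π, m, G, hπ, hX, hG⟩ := FThreshold.exists_presentation φ hφ
  obtain ⟨l, a, ha⟩ :=
    Submodule.fg_iff_exists_fin_generating_family.1 (IsNoetherian.noetherian 𝔞)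
  choose f hf using fun j => hπ (a j)
  obtain rfl : Ideal.span (Set.range fun j => π (f j)) = 𝔞 := by simpa only [hf] using ha
  exact FThreshold.isOpen_setOf_le_fpt hφ hπ hX hG hp hreg hdim
    (fun q j => h𝔞 q (Ideal.subset_span ⟨j, rfl⟩)) hc
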